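/- Let $d,N\ge 1$, and equip $(\mathbb{R}^d)^N$ with its Euclidean inner product $X\cdot Y$ and norm $|\cdot|$. For $X=(x_1,\dots,x_N)\in(\mathbb{R}^d)^N$ and a permutation $\sigma\in\mathfrak{S}_N$ put $X^\sigma=(x_{\sigma(1)},\dots,x_{\sigma(N)})$. Let $A,P,Q\in(\mathbb{R}^d)^N$, let $0<t_0<t_1$, and let $\beta:(0,\infty)\to(0,\infty)$ be smooth. For $\varepsilon,t>0$ and $X\in(\mathbb{R}^d)^N$ define $$f_\varepsilon(t,X)=\varepsilon t\log\Big[\frac1{N!}\sum_{\sigma\in\mathfrak{S}_N}\exp\Big(\frac{X\cdot A^\sigma}{t\varepsilon}\Big)\Big],\qquad f(X)=\max_{\sigma\in\mathfrak{S}_N}X\cdot A^\sigma,$$ let $\nabla f_\varepsilon(t,X)$ be the gradient of $f_\varepsilon(t,\cdot)$ at $X$, and let $\overline\nabla f(X)$ be the element of minimal Euclidean norm of the subdifferential $\partial f(X)$ of the convex function $f$. For a curve $\mathcal X=(X_t)_{t\in[t_0,t_1]}\in C^0([t_0,t_1];(\mathbb{R}^d)^N)$ set $$L_\varepsilon(\mathcal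 X)=\int_{t_0}^{t_1}\Big|\dot X_t-\frac{X_t-\nabla f_\varepsilon(t,X_t)}{2t}\Big|^2\beta(t)\,dt,\qquad L(\mathcal X)=\int_{t_0}^{t_1}\Big|\dot X_t-\frac{X_t-\overline\nabla f(X_t)}{2t}\Big|^2\beta(t)\,dt$$ if $\mathcal X\in H^1([t_0,t_1];(\mathbb{R}^d)^N)$, $X_{t_0}\in\{P^\sigma:\sigma\in\mathfrak{S}_N\}$ and $X_{t_1}\in\{Q^\sigma:\sigma\in\mathfrak{S}_N\}$, and $L_\varepsilon(\mathcal X)=L(\mathcal X)=+\infty$ otherwise. Then, as $\varepsilon\to0$, $(L_\varepsilon)_{\varepsilon>0}$ $\Gamma$-converges to $L$ for the topology of uniform convergence on $C^0([t_0,t_1];(\mathbb{R}^d)^N)$. That is, for every $\mathcal X\in C^0([t_0,t_1];(\mathbb{R}^d)^N)$: 1. for every family $(\mathcal X^\varepsilon)_{\varepsilon>0}$ in $C^0([t_0,t_1];(\mathbb{R}^d)^N)$ converging uniformly to $\mathcal X$ as $\varepsilon\to0$, one has $L(\mathcal X)\le\liminf_{\varepsilon\to0}L_\varepsilon(\mathcal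 X^\varepsilon)$; 2. there is a family $(\mathcal X^\varepsilon)_{\varepsilon>0}$ in $C^0([t_0,t_1];(\mathbb{R}^d)^N)$ converging uniformly to $\mathcal X$ as $\varepsilon\to0$ with $\limsup_{\varepsilon\to0}L_\varepsilon(\mathcal X^\varepsilon)\le L(\mathcal X)$. -/

import Mathlib

open Set Filter Topology MeasureTheory
open scoped ENNReal ContDiff

noncomputable section

namespace MongeAmpere

/-! ### Γ-convergence -/

/-- Γ-convergence, as `ε ↓ 0`, of a family `(F ε)_{ε > 0}` of `[0, +∞]`-valued functionals
on a metrizable space `S` to `F₀`. -/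
structure GammaConverges {S : Type*} [TopologicalSpace S]
    (F : ℝ → S → ℝ≥0∞) (F₀ : S → ℝ≥0∞) : Prop where
  liminf_ge : ∀ (x : S) (u : ℝ → S), Tendsto u (𝓝[>] 0) (𝓝 x) →
    F₀ x ≤ liminf (fun ε => F ε (u ε)) (𝓝[>] 0)
  exists_recovery : ∀ x : S, ∃ u : ℝ → S, Tendsto u (𝓝[>] 0) (𝓝 x) ∧
    limsup (fun ε => F ε (u ε)) (𝓝[>] 0) ≤ F₀ x

/-! ### Subdifferential and extended gradient -/

section ExtendedGradient

variable {H : Type*} [NormedAddCommGroup H] [InnerProductSpace ℝ H]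

/-- The subdifferential of a (convex) function at a point. -/
def subdifferential (h : H → ℝ) (x : H) : Set H :=
  {g | ∀ y, h x + inner ℝ g (y - x) ≤ h y}

/-- `g` is an element of minimal norm of the subdifferential of `h` at `x`. -/
def IsMinimalSubgradient (h : H → ℝ) (x g : H) : Prop :=
  g ∈ subdifferential h x ∧ ∀ g' ∈ subdifferential h x, ‖g‖ ≤ ‖g'‖

/-- The extended gradient of `h` at `x`: the element of minimal norm of the subdifferential. -/
def extendedGradient (h : H → ℝ) (x : H) : H :=
  Classical.epsilon (IsMinimalSubgradient h x)

theorem convex_subdifferential (h : H → ℝ) (x : H) : Convex ℝ (subdifferential h x) := by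
  intro g₁ h₁ g₂ h₂ a b ha hb hab y
  have e₁ := mul_le_mul_of_nonneg_left (h₁ y) ha
  have e₂ := mul_le_mul_of_nonneg_left (h₂ y) hb
  have e₃ : inner ℝ (a • g₁ + b • g₂) (y - x)
      = a * inner ℝ g₁ (y - x) + b * inner ℝ g₂ (y - x) := by
    simp [inner_add_left, real_inner_smul_left]
  obtain rfl : b = 1 - a := by linarith
  rw [e₃]
  linarith

theorem isClosed_subdifferential (h : H → ℝ) (x : H) : IsClosed (subdifferential h x) := by
  have e : subdifferential h x = ⋂ y, {g | h x + inner ℝ g (y - x) ≤ h y} := by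
    ext g
    simp [subdifferential]
  rw [e]
  exact isClosed_iInter fun y => isClosed_le (by fun_prop) continuous_const

/-- A minimal subgradient is unique. -/
theorem IsMinimalSubgradient.unique {h : H → ℝ} {x g₁ g₂ : H}
    (h₁ : IsMinimalSubgradient h x g₁) (h₂ : IsMinimalSubgradient h x g₂) : g₁ = g₂ := by
  have hm : (1 / 2 : ℝ) • g₁ + (1 / 2 : ℝ) • g₂ ∈ subdifferential h x :=
    convex_subdifferential h x h₁.1 h₂.1 (by norm_num) (by norm_num) (by norm_num)
  have e : ‖g₁‖ = ‖g₂‖ := le_antisymm (h₁.2 _ h₂.1) (h₂.2 _ h₁.1)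
  have l := h₁.2 _ hm
  rw [← smul_add, norm_smul] at l
  have l' : 2 * ‖g₁‖ ≤ ‖g₁ + g₂‖ := by
    norm_num at l
    linarith
  have p := parallelogram_law_with_norm ℝ g₁ g₂
  have z : ‖g₁ - g₂‖ = 0 := by
    rw [← e] at p
    nlinarith [norm_nonneg g₁, norm_nonneg (g₁ - g₂), norm_nonneg (g₁ + g₂)]
  exact sub_eq_zero.mp (norm_eq_zero.mp z)

/-- As soon as the subdifferential is nonempty, the extended gradient is its element of
minimal norm. -/
theorem extendedGradient_spec [CompleteSpace H] {h : H → ℝ} {x : H}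
    (hne : (subdifferential h x).Nonempty) :
    IsMinimalSubgradient h x (extendedGradient h x) := by
  apply Classical.epsilon_spec
  obtain ⟨g, hg, hmin⟩ := exists_norm_eq_iInf_of_complete_convex hne
    (isClosed_subdifferential h x).isComplete (convex_subdifferential h x) 0
  refine ⟨g, hg, fun g' hg' => ?_⟩
  have hb : BddBelow (range fun w : subdifferential h x => ‖(0 : H) - w‖) :=
    ⟨0, by rintro _ ⟨w, rfl⟩; exact norm_nonneg _⟩
  have := hmin.le.trans (ciInf_le hb ⟨g', hg'⟩)
  simpa using this

end ExtendedGradient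

/-! ### Configurations of `N` points in `ℝ^d` and the potentials -/

/-- `(ℝ^d)^N` with its Euclidean structure. -/
abbrev Config (d N : ℕ) : Type := PiLp 2 (fun _ : Fin N => EuclideanSpace ℝ (Fin d))

/-- `X^σ = (x_{σ(1)}, …, x_{σ(N)})`. -/
def permute {d N : ℕ} (X : Config d N) (σ : Equiv.Perm (Fin N)) : Config d N :=
  WithLp.toLp 2 (fun i => X (σ i))

/-- `f_ε(t, X) = ε t log ( (1 / N!) ∑_σ exp (X · A^σ / (t ε)) )`. -/
def fEps {d N : ℕ} (A : Config d N) (ε t : ℝ) (X : Config d N) : ℝ :=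
  ε * t * Real.log ((1 / (Nat.factorial N : ℝ)) *
    ∑ σ : Equiv.Perm (Fin N), Real.exp (inner ℝ X (permute A σ) / (t * ε)))

/-- `f(X) = max_σ X · A^σ`. -/
def fMax {d N : ℕ} (A X : Config d N) : ℝ :=
  Finset.univ.sup' Finset.univ_nonempty
    (fun σ : Equiv.Perm (Fin N) => inner ℝ X (permute A σ))

/-- `f_ε(t, ·)` is differentiable, so that its `gradient` is the genuine one. -/
theorem differentiable_fEps {d N : ℕ} (A : Config d N) (ε t : ℝ) :
    Differentiable ℝ (fEps A ε t) := by
  intro X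
  have hpos : (1 / (Nat.factorial N : ℝ)) *
      ∑ σ : Equiv.Perm (Fin N), Real.exp (inner ℝ X (permute A σ) / (t * ε)) ≠ 0 := by
    have h1 : (0 : ℝ) < Nat.factorial N := by exact_mod_cast Nat.factorial_pos N
    have h2 : 0 < ∑ σ : Equiv.Perm (Fin N), Real.exp (inner ℝ X (permute A σ) / (t * ε)) :=
      Finset.sum_pos (fun _ _ => Real.exp_pos _) Finset.univ_nonempty
    positivity
  have hd : DifferentiableAt ℝ (fun Y : Config d N => (1 / (Nat.factorial N : ℝ)) *
      ∑ σ : Equiv.Perm (Fin N), Real.exp (inner ℝ Y (permute A σ) / (t * ε))) X := by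
    refine DifferentiableAt.const_mul (DifferentiableAt.fun_sum fun σ _ => ?_) _
    have hi : DifferentiableAt ℝ
        (fun Y : Config d N => (inner ℝ Y (permute A σ) : ℝ) / (t * ε)) X := by
      simp only [div_eq_mul_inv]
      exact DifferentiableAt.mul_const
        (DifferentiableAt.inner ℝ differentiableAt_fun_id (differentiableAt_const _)) _
    exact hi.exp
  exact (hd.log hpos).const_mul _

/-- The subdifferential of `f` is nonempty everywhere, so that its `extendedGradient` is the
genuine one. -/
theorem subdifferential_fMax_nonempty {d N : ℕ} (A X : Config d N) :
    (subdifferential (fMax A) X).Nonempty := by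
  obtain ⟨σ, _, hσ⟩ := Finset.exists_mem_eq_sup' Finset.univ_nonempty
    (fun σ : Equiv.Perm (Fin N) => inner ℝ X (permute A σ))
  refine ⟨permute A σ, fun Y => ?_⟩
  have h1 : fMax A X = inner ℝ X (permute A σ) := hσ
  have h2 : inner ℝ Y (permute A σ) ≤ fMax A Y :=
    Finset.le_sup' (fun σ : Equiv.Perm (Fin N) => inner ℝ Y (permute A σ)) (Finset.mem_univ σ)
  rw [h1, inner_sub_right, real_inner_comm, real_inner_comm X]
  rw [real_inner_comm] at h2
  linarith [real_inner_comm X (permute A σ), real_inner_comm Y (permute A σ)]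

/-! ### Curves and actions -/

section Curves

variable {E : Type*} [NormedAddCommGroup E] [InnerProductSpace ℝ E]
variable {t₀ t₁ : ℝ} (h : t₀ ≤ t₁)

/-- `X_t`, for a curve `X ∈ C⁰([t₀, t₁]; E)` (extended by constants outside `[t₀, t₁]`). -/
def pos (X : C(Icc t₀ t₁, E)) : ℝ → E := IccExtend h X

/-- `X ∈ H¹([t₀, t₁]; E)`: the curve is the primitive of some `V ∈ L²([t₀, t₁]; E)`. -/
def IsH1 (X : C(Icc t₀ t₁, E)) : Prop :=
  ∃ V : ℝ → E, MemLp V 2 (volume.restrict (Icc t₀ t₁)) ∧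
    ∀ t ∈ Icc t₀ t₁, pos h X t = pos h X t₀ + ∫ s in t₀..t, V s

/-- The velocity `Ẋ_t`. For an `H¹` curve it exists for almost every `t ∈ [t₀, t₁]`. -/
def velocity (X : C(Icc t₀ t₁, E)) : ℝ → E := deriv (pos h X)

/-- The velocity of an `H¹` curve agrees almost everywhere with its `L²` derivative. -/
theorem velocity_ae_eq [CompleteSpace E] (X : C(Icc t₀ t₁, E)) {V : ℝ → E}
    (hV : MemLp V 2 (volume.restrict (Icc t₀ t₁)))
    (hX : ∀ t ∈ Icc t₀ t₁, pos h X t = pos h X t₀ + ∫ s in t₀..t, V s) :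
    ∀ᵐ t ∂volume.restrict (Icc t₀ t₁), HasDerivAt (pos h X) (V t) t ∧ velocity h X t = V t := by
  have hi : IntervalIntegrable V volume t₀ t₁ := by
    rw [intervalIntegrable_iff_integrableOn_Icc_of_le h]
    exact hV.integrable (by norm_num)
  rw [← restrict_Ioo_eq_restrict_Icc, ae_restrict_iff' measurableSet_Ioo]
  filter_upwards [hi.ae_hasDerivAt_integral] with t ht hmem
  have hmem' : t ∈ uIcc t₀ t₁ := by
    rw [uIcc_of_le h]
    exact Ioo_subset_Icc_self hmem
  have hd : HasDerivAt (pos h X) (V t) t := by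
    refine ((ht hmem' t₀ left_mem_uIcc).const_add (pos h X t₀)).congr_of_eventuallyEq ?_
    filter_upwards [Ioo_mem_nhds hmem.1 hmem.2] with s hs
    exact hX s (Ioo_subset_Icc_self hs)
  exact ⟨hd, hd.deriv⟩

end Curves

open Classical in
/-- The action
`∫_{t₀}^{t₁} |Ẋ_t - (X_t - G(t, X_t)) / (2 t)|² β(t) dt`
of a curve joining `{P^σ}` to `{Q^σ}` in `H¹`, and `+∞` for all other continuous curves. -/
def action {d N : ℕ} (P Q : Config d N) {t₀ t₁ : ℝ} (h : t₀ ≤ t₁) (β : ℝ → ℝ)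
    (G : ℝ → Config d N → Config d N) (X : C(Icc t₀ t₁, Config d N)) : ℝ≥0∞ :=
  if IsH1 h X ∧ (∃ σ, pos h X t₀ = permute P σ) ∧ (∃ σ, pos h X t₁ = permute Q σ) then
    ∫⁻ t in Icc t₀ t₁, ENNReal.ofReal
      (‖velocity h X t - (1 / (2 * t)) • (pos h X t - G t (pos h X t))‖ ^ 2 * β t)
  else ⊤

/-- The Freidlin–Wentzell action `L_ε`. -/
def actionEps {d N : ℕ} (A P Q : Config d N) {t₀ t₁ : ℝ} (h : t₀ ≤ t₁) (β : ℝ → ℝ)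
    (ε : ℝ) : C(Icc t₀ t₁, Config d N) → ℝ≥0∞ :=
  action P Q h β (fun t Y => gradient (fEps A ε t) Y)

/-- The limit action `L`. -/
def actionLim {d N : ℕ} (A P Q : Config d N) {t₀ t₁ : ℝ} (h : t₀ ≤ t₁) (β : ℝ → ℝ) :
    C(Icc t₀ t₁, Config d N) → ℝ≥0∞ :=
  action P Q h β (fun _ Y => extendedGradient (fMax A) Y)

end MongeAmpere

end

/-!
The change of variable `Z_t = X_t / t` makes the approximate potentials independent of time: the
gradient of `f_ε(t, ·)` at `X` is the gradient `gibbsMean a ε` of the soft maximum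
`softMax a ε z = ε log (mean of exp (⟪z, a_σ⟫ / ε))`, `a_σ = A^σ`, taken at `X / t`. The drift
`Ẋ - (X - ∇f_ε) / (2 t)` becomes `t Z' + Z / 2 + g(Z) / (2 t)`, and the action expands into

* the kinetic part `∫ t² β |Z'|²`,
* the slope part `∫ β / (4 t²) |g(Z)|²`,
* mixed terms which, after an integration by parts, depend only on the values of `Z`: indeed
  `⟪g(Z), Z'⟫` is the derivative of the potential along `Z`, and `⟪g(Z), Z⟫` is within
  `ε log N!` of `f(Z)`, with equality to `f(Z)` in the limit since `f` is positively homogeneous.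

The mixed terms (`crossTerm`) converge under uniform convergence (`tendsto_crossTerm_softMax`),
so only the two quadratic parts matter.

*Lower bound.* The kinetic part is weakly lower semicontinuous, by weak compactness in `L²`
(`isSobolev_and_kinetic_le_of_tendsto`). Limits of Gibbs means are subgradients of `f`, hence at
least as long as the minimal one; Fatou's lemma then treats the slope part
(`ofReal_slope_le_liminf`).

*Recovery.* Let `J` be the resolvent of the soft maximum with parameter `τ`, so that
`J z + τ g(J z) = z`. It is nonexpansive, so `W = J ∘ Z` has no more kinetic energy than `Z`, and
`|g(J z)|² ≤ |p|² + 2 (ε / τ) log N!` for every subgradient `p` of `f` at `z`, by comparing the two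
convexity inequalities between `z` and `J z` (`norm_sq_resolvent_subgradient_le`). With `ε = s⁴` and
`τ = s²` the slope part is asymptotically no larger either. The endpoints, moved by `O(s²)`, are
restored by affine boundary layers of width `s`, which cost `O(s)` (`exists_recovery_curve`).
-/

noncomputable section

namespace MongeAmpere

/-! ### Subgradients and log-sum-exp approximations -/

section Subgradients

variable {H : Type*} [NormedAddCommGroup H] [InnerProductSpace ℝ H]

/-- Subgradients are monotone. -/
theorem inner_sub_nonneg_of_mem_subdifferential {h : H → ℝ} {x y p q : H}
    (hp : p ∈ subdifferential h x) (hq : q ∈ subdifferential h y) :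
    0 ≤ inner ℝ (p - q) (x - y) := by
  have h₁ := hp y
  have h₂ := hq x
  rw [← neg_sub x y, inner_neg_right] at h₁
  rw [inner_sub_left]
  linarith

/-- A function with a continuous selection of subgradients is differentiable, and the selection
is its gradient: `0 ≤ h y - h x - ⟪g x, y - x⟫ ≤ ⟪g y - g x, y - x⟫`. -/
theorem hasGradientAt_of_continuous_subgradient [CompleteSpace H] {h : H → ℝ} {g : H → H}
    (hg : ∀ x, g x ∈ subdifferential h x) (hc : Continuous g) (x : H) :
    HasGradientAt h (g x) x := by
  rw [hasGradientAt_iff_isLittleO, Asymptotics.isLittleO_iff]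
  intro c hcpos
  have hev : ∀ᶠ y in 𝓝 x, ‖g y - g x‖ ≤ c := by
    have := (hc.tendsto x).eventually (Metric.closedBall_mem_nhds (g x) hcpos)
    filter_upwards [this] with y hy
    simpa [dist_eq_norm] using hy
  filter_upwards [hev] with y hy
  have h₁ := hg x y
  have h₂ := hg y x
  have h₃ : inner ℝ (g y - g x) (y - x) ≤ c * ‖y - x‖ :=
    (real_inner_le_norm _ _).trans (mul_le_mul_of_nonneg_right hy (norm_nonneg _))
  rw [← neg_sub y x, inner_neg_right] at h₂
  rw [inner_sub_left] at h₃
  rw [Real.norm_eq_abs, abs_of_nonneg (by linarith)]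
  linarith

theorem lipschitzWith_of_bounded_subgradient {h : H → ℝ} {g : H → H} {R : NNReal}
    (hg : ∀ x, g x ∈ subdifferential h x) (hR : ∀ x, ‖g x‖ ≤ R) : LipschitzWith R h := by
  refine LipschitzWith.of_le_add_mul R fun x y => ?_
  have h₁ := hg x y
  have h₂ : inner ℝ (g x) (x - y) ≤ R * ‖x - y‖ :=
    (real_inner_le_norm _ _).trans (mul_le_mul_of_nonneg_right (hR x) (norm_nonneg _))
  rw [← neg_sub x y, inner_neg_right] at h₁
  rw [dist_eq_norm]
  linarith

/-- Limits of subgradients are subgradients, for pointwise limits of functions whose values along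
the base points converge. -/
theorem mem_subdifferential_of_tendsto {ι : Type*} {l : Filter ι} [l.NeBot] {h : ι → H → ℝ}
    {h₀ : H → ℝ} {x g : ι → H} {x₀ g₀ : H} (hh : ∀ y, Tendsto (fun i => h i y) l (𝓝 (h₀ y)))
    (hx : Tendsto x l (𝓝 x₀)) (hhx : Tendsto (fun i => h i (x i)) l (𝓝 (h₀ x₀)))
    (hg : Tendsto g l (𝓝 g₀)) (hmem : ∀ᶠ i in l, g i ∈ subdifferential (h i) (x i)) :
    g₀ ∈ subdifferential h₀ x₀ := fun y =>
  le_of_tendsto_of_tendsto (hhx.add (hg.inner (hx.const_sub y))) (hh y)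
    (hmem.mono fun _ hi => hi y)

end Subgradients

section SoftMax

variable {ι : Type*} [Fintype ι]
variable {H : Type*} [NormedAddCommGroup H] [InnerProductSpace ℝ H]

/-- The normalized log-sum-exp approximation of `maxInner a` at temperature `ε`. -/
def softMax (a : ι → H) (ε : ℝ) (z : H) : ℝ :=
  ε * Real.log ((1 / (Fintype.card ι : ℝ)) * ∑ i, Real.exp (inner ℝ z (a i) / ε))

/-- The Gibbs weight of the index `i` at temperature `ε`. -/
def gibbsWeight (a : ι → H) (ε : ℝ) (z : H) (i : ι) : ℝ :=
  Real.exp (inner ℝ z (a i) / ε) / ∑ j, Real.exp (inner ℝ z (a j) / ε)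

/-- The mean of the family `a` under the Gibbs weights: the gradient of `softMax a ε`. -/
def gibbsMean (a : ι → H) (ε : ℝ) (z : H) : H := ∑ i, gibbsWeight a ε z i • a i

variable (a : ι → H) (ε : ℝ) (z : H)

theorem inner_gibbsMean (w : H) :
    inner ℝ (gibbsMean a ε z) w = ∑ i, gibbsWeight a ε z i * inner ℝ w (a i) := by
  simp only [gibbsMean, sum_inner, real_inner_smul_left]
  exact Finset.sum_congr rfl fun i _ => by rw [real_inner_comm]

variable [Nonempty ι]

/-- The support function `z ↦ max_i ⟪z, a_i⟫` of a finite family of vectors. -/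
def maxInner (a : ι → H) (z : H) : ℝ :=
  Finset.univ.sup' Finset.univ_nonempty fun i => inner ℝ z (a i)

theorem sum_exp_pos : 0 < ∑ i, Real.exp (inner ℝ z (a i) / ε) :=
  Finset.sum_pos (fun _ _ => Real.exp_pos _) Finset.univ_nonempty

theorem gibbsWeight_nonneg (i : ι) : 0 ≤ gibbsWeight a ε z i :=
  div_nonneg (Real.exp_pos _).le (sum_exp_pos a ε z).le

theorem sum_gibbsWeight : ∑ i, gibbsWeight a ε z i = 1 := by
  simp only [gibbsWeight]
  rw [← Finset.sum_div, div_self (sum_exp_pos a ε z).ne']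

theorem inner_le_maxInner (i : ι) : inner ℝ z (a i) ≤ maxInner a z :=
  Finset.le_sup' (fun i => inner ℝ z (a i)) (Finset.mem_univ i)

theorem exists_maxInner_eq : ∃ i, maxInner a z = inner ℝ z (a i) := by
  obtain ⟨i, -, hi⟩ := Finset.exists_mem_eq_sup' Finset.univ_nonempty
    (fun i => (inner ℝ z (a i) : ℝ))
  exact ⟨i, hi⟩

theorem inner_gibbsMean_le_maxInner : inner ℝ (gibbsMean a ε z) z ≤ maxInner a z := by
  rw [inner_gibbsMean]
  calc ∑ i, gibbsWeight a ε z i * inner ℝ z (a i)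
      ≤ ∑ i, gibbsWeight a ε z i * maxInner a z := Finset.sum_le_sum fun i _ =>
        mul_le_mul_of_nonneg_left (inner_le_maxInner a z i) (gibbsWeight_nonneg a ε z i)
    _ = maxInner a z := by rw [← Finset.sum_mul, sum_gibbsWeight, one_mul]

theorem norm_gibbsMean_le {R : ℝ} (hR : ∀ i, ‖a i‖ ≤ R) : ‖gibbsMean a ε z‖ ≤ R := by
  calc ‖gibbsMean a ε z‖ ≤ ∑ i, gibbsWeight a ε z i * R := norm_sum_le_of_le _ fun i _ => by
        rw [norm_smul, Real.norm_of_nonneg (gibbsWeight_nonneg a ε z i)]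
        exact mul_le_mul_of_nonneg_left (hR i) (gibbsWeight_nonneg a ε z i)
    _ = R := by rw [← Finset.sum_mul, sum_gibbsWeight, one_mul]

theorem continuous_gibbsMean : Continuous (gibbsMean a ε) := by
  refine continuous_finsetSum _ fun i _ => Continuous.smul ?_ continuous_const
  refine Continuous.div (by fun_prop) (by fun_prop) fun z => (sum_exp_pos a ε z).ne'

/-- The Gibbs mean is a subgradient of the soft maximum: with `m` the Gibbs mean of
`u_i = ⟪y - z, a_i⟫ / ε`, the convexity inequality is
`∑ p_i exp u_i ≥ exp m * ∑ p_i (1 + u_i - m) = exp m`. -/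
theorem gibbsMean_mem_subdifferential (hε : 0 < ε) :
    gibbsMean a ε z ∈ subdifferential (softMax a ε) z := by
  intro y
  have hcard : (0 : ℝ) < 1 / (Fintype.card ι : ℝ) :=
    one_div_pos.2 (Nat.cast_pos.2 Fintype.card_pos)
  have hz := sum_exp_pos a ε z
  have hy := sum_exp_pos a ε y
  set m : ℝ := inner ℝ (gibbsMean a ε z) (y - z) / ε with hm
  have hmsum : m = ∑ i, gibbsWeight a ε z i * (inner ℝ (y - z) (a i) / ε) := by
    rw [hm, inner_gibbsMean, Finset.sum_div]
    exact Finset.sum_congr rfl fun i _ => by ring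
  have key : Real.exp m * ∑ i, Real.exp (inner ℝ z (a i) / ε)
      ≤ ∑ i, Real.exp (inner ℝ y (a i) / ε) := by
    have h₁ : ∑ i, Real.exp (inner ℝ y (a i) / ε) = (Real.exp m *
        ∑ i, gibbsWeight a ε z i * Real.exp (inner ℝ (y - z) (a i) / ε - m)) *
          ∑ i, Real.exp (inner ℝ z (a i) / ε) := by
      rw [mul_assoc, Finset.sum_mul, Finset.mul_sum]
      refine Finset.sum_congr rfl fun i _ => ?_
      have e : Real.exp (inner ℝ y (a i) / ε) = Real.exp (inner ℝ z (a i) / ε) *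
          (Real.exp m * Real.exp (inner ℝ (y - z) (a i) / ε - m)) := by
        rw [← Real.exp_add, ← Real.exp_add, inner_sub_left]
        congr 1
        ring
      rw [e, gibbsWeight]
      field_simp
    have h₂ : 1 ≤ ∑ i, gibbsWeight a ε z i * Real.exp (inner ℝ (y - z) (a i) / ε - m) := by
      calc (1 : ℝ) = ∑ i, gibbsWeight a ε z i * (inner ℝ (y - z) (a i) / ε - m + 1) := by
            simp only [mul_add, mul_sub, Finset.sum_add_distrib, Finset.sum_sub_distrib]
            rw [← hmsum, ← Finset.sum_mul, ← Finset.sum_mul, sum_gibbsWeight]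
            ring
        _ ≤ _ := Finset.sum_le_sum fun i _ => mul_le_mul_of_nonneg_left
            (Real.add_one_le_exp _) (gibbsWeight_nonneg a ε z i)
    rw [h₁]
    refine mul_le_mul_of_nonneg_right ?_ hz.le
    exact le_mul_of_one_le_right (Real.exp_pos m).le h₂
  have hlog := Real.log_le_log (mul_pos hcard (mul_pos (Real.exp_pos m) hz))
    (mul_le_mul_of_nonneg_left key hcard.le)
  rw [mul_left_comm, Real.log_mul (Real.exp_pos m).ne' (mul_pos hcard hz).ne', Real.log_exp]
    at hlog
  have := mul_le_mul_of_nonneg_left hlog hε.le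
  rw [mul_add, hm, mul_div_cancel₀ _ hε.ne'] at this
  simp only [softMax]
  linarith

theorem softMax_zero : softMax a ε 0 = 0 := by
  have : (Fintype.card ι : ℝ) ≠ 0 := Nat.cast_ne_zero.2 Fintype.card_ne_zero
  simp [softMax, this]

theorem softMax_le_inner_gibbsMean (hε : 0 < ε) :
    softMax a ε z ≤ inner ℝ (gibbsMean a ε z) z := by
  have := gibbsMean_mem_subdifferential a ε z hε 0
  rw [softMax_zero, zero_sub, inner_neg_right] at this
  linarith

/-- The soft maximum lies below the maximum by at most `ε log (card ι)`. -/
theorem maxInner_sub_le_softMax (hε : 0 < ε) :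
    maxInner a z - ε * Real.log (Fintype.card ι) ≤ softMax a ε z := by
  obtain ⟨i, hi⟩ := exists_maxInner_eq a z
  have hcard : (0 : ℝ) < (Fintype.card ι : ℝ) := Nat.cast_pos.2 Fintype.card_pos
  have h₁ : Real.exp (inner ℝ z (a i) / ε) ≤ ∑ j, Real.exp (inner ℝ z (a j) / ε) :=
    Finset.single_le_sum (f := fun j => Real.exp (inner ℝ z (a j) / ε))
      (fun _ _ => (Real.exp_pos _).le) (Finset.mem_univ i)
  have h₂ := Real.log_le_log (Real.exp_pos _) h₁
  rw [Real.log_exp, div_le_iff₀ hε, mul_comm] at h₂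
  rw [softMax, one_div, Real.log_mul (inv_ne_zero hcard.ne') (sum_exp_pos a ε z).ne',
    Real.log_inv, hi]
  linarith

theorem softMax_le_maxInner (hε : 0 < ε) : softMax a ε z ≤ maxInner a z :=
  (softMax_le_inner_gibbsMean a ε z hε).trans (inner_gibbsMean_le_maxInner a ε z)

theorem mem_subdifferential_maxInner {i : ι} (hi : maxInner a z = inner ℝ z (a i)) :
    a i ∈ subdifferential (maxInner a) z := by
  intro y
  have := inner_le_maxInner a y i
  rw [hi, inner_sub_right, real_inner_comm y, real_inner_comm z]
  linarith

theorem subdifferential_maxInner_nonempty : (subdifferential (maxInner a) z).Nonempty := by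
  obtain ⟨i, hi⟩ := exists_maxInner_eq a z
  exact ⟨a i, mem_subdifferential_maxInner a z hi⟩

theorem norm_extendedGradient_maxInner_le [CompleteSpace H] {R : ℝ} (hR : ∀ i, ‖a i‖ ≤ R) :
    ‖extendedGradient (maxInner a) z‖ ≤ R := by
  obtain ⟨i, hi⟩ := exists_maxInner_eq a z
  exact ((extendedGradient_spec (subdifferential_maxInner_nonempty a z)).2 _
    (mem_subdifferential_maxInner a z hi)).trans (hR i)

theorem maxInner_smul {c : ℝ} (hc : 0 ≤ c) : maxInner a (c • z) = c * maxInner a z := by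
  apply le_antisymm
  · obtain ⟨i, hi⟩ := exists_maxInner_eq a (c • z)
    rw [hi, real_inner_smul_left]
    exact mul_le_mul_of_nonneg_left (inner_le_maxInner a z i) hc
  · obtain ⟨i, hi⟩ := exists_maxInner_eq a z
    rw [hi, ← real_inner_smul_left]
    exact inner_le_maxInner a _ i

/-- Euler's relation for the positively homogeneous function `maxInner a`. -/
theorem inner_eq_maxInner_of_mem_subdifferential {g : H}
    (hg : g ∈ subdifferential (maxInner a) z) : inner ℝ g z = maxInner a z := by
  have h₀ := hg ((0 : ℝ) • z)
  have h₂ := hg ((2 : ℝ) • z)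
  rw [maxInner_smul a z le_rfl, zero_smul, zero_sub, inner_neg_right] at h₀
  rw [maxInner_smul a z zero_le_two, two_smul, add_sub_cancel_right] at h₂
  linarith

/-- The subdifferential of `maxInner a` is constant along open rays from the origin. -/
theorem subdifferential_maxInner_smul {c : ℝ} (hc : 0 < c) :
    subdifferential (maxInner a) (c • z) = subdifferential (maxInner a) z := by
  have key : ∀ (b : ℝ) (w : H), 0 < b →
      subdifferential (maxInner a) w ⊆ subdifferential (maxInner a) (b • w) := by
    intro b w hb g hg y
    have h₁ := mul_le_mul_of_nonneg_left (hg (b⁻¹ • y)) hb.le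
    rw [maxInner_smul a y (inv_pos.2 hb).le, mul_inv_cancel_left₀ hb.ne', mul_add,
      ← real_inner_smul_right, smul_sub, smul_inv_smul₀ hb.ne'] at h₁
    rwa [maxInner_smul a w hb.le]
  refine Subset.antisymm ?_ (key c z hc)
  simpa [smul_smul, inv_mul_cancel₀ hc.ne'] using key c⁻¹ (c • z) (inv_pos.2 hc)

theorem extendedGradient_maxInner_smul {c : ℝ} (hc : 0 < c) :
    extendedGradient (maxInner a) (c • z) = extendedGradient (maxInner a) z := by
  have : IsMinimalSubgradient (maxInner a) (c • z) = IsMinimalSubgradient (maxInner a) z := by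
    ext g
    simp only [IsMinimalSubgradient, subdifferential_maxInner_smul a z hc]
  rw [extendedGradient, this, extendedGradient]

theorem continuous_maxInner : Continuous (maxInner a) :=
  Continuous.finset_sup'_apply _ fun i _ => by fun_prop

theorem abs_softMax_sub_maxInner_le (hε : 0 < ε) :
    |softMax a ε z - maxInner a z| ≤ ε * Real.log (Fintype.card ι) := by
  have h₁ := maxInner_sub_le_softMax a ε z hε
  have h₂ := softMax_le_maxInner a ε z hε
  rw [abs_of_nonpos (by linarith)]
  linarith

theorem abs_inner_gibbsMean_sub_le (hε : 0 < ε) :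
    |inner ℝ (gibbsMean a ε z) z - maxInner a z| ≤ ε * Real.log (Fintype.card ι) := by
  have h₁ := maxInner_sub_le_softMax a ε z hε
  have h₂ := softMax_le_inner_gibbsMean a ε z hε
  have h₃ := inner_gibbsMean_le_maxInner a ε z
  rw [abs_of_nonpos (by linarith)]
  linarith

end SoftMax

/-! ### Resolvents, and semicontinuity of the minimal subgradient -/

section Resolvent

variable {H : Type*} [NormedAddCommGroup H] [InnerProductSpace ℝ H]

/-- The resolvent equation `w + τ g(w) = z` of a continuous bounded subgradient field `g` is
solvable: `w` is a minimizer of `Φ + ‖· - z‖² / (2 τ)`. -/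
theorem exists_resolvent [FiniteDimensional ℝ H] {Φ : H → ℝ} {g : H → H} {R τ : ℝ}
    (hg : ∀ x, g x ∈ subdifferential Φ x) (hc : Continuous g) (hR : ∀ x, ‖g x‖ ≤ R)
    (hτ : 0 < τ) (z : H) : ∃ w, w + τ • g w = z := by
  have : ProperSpace H := FiniteDimensional.proper_real H
  have hgrad := hasGradientAt_of_continuous_subgradient hg hc
  set Ψ : H → ℝ := fun w => τ * Φ w + ‖w - z‖ ^ 2 / 2 with hΨ
  have hd : ∀ w, HasFDerivAt Ψ (innerSL ℝ (τ • g w + (w - z))) w := by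
    intro w
    have h₁ := ((hgrad w).hasFDerivAt.const_mul τ).add
      ((((hasFDerivAt_id w).sub_const z).norm_sq).mul_const (1 / 2 : ℝ))
    refine (h₁.congr_fderiv ?_).congr_of_eventuallyEq (Eventually.of_forall fun y => ?_)
    · ext v
      simp
    · simp [hΨ, div_eq_mul_inv]
  have hcont : Continuous Ψ := continuous_iff_continuousAt.2 fun w => (hd w).continuousAt
  have hcoer : ∀ᶠ w in cocompact H, Ψ z ≤ Ψ w := by
    filter_upwards [(isCompact_closedBall z (2 * (τ * R))).compl_mem_cocompact] with w hw
    have hw' : 2 * (τ * R) < ‖w - z‖ := by simpa [dist_eq_norm] using hw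
    have h₁ : -(R * ‖w - z‖) ≤ inner ℝ (g z) (w - z) :=
      (abs_le.1 ((abs_real_inner_le_norm _ _).trans
        (mul_le_mul_of_nonneg_right (hR z) (norm_nonneg _)))).1
    have h₂ := mul_le_mul_of_nonneg_left (hg z w) hτ.le
    have h₃ := mul_le_mul_of_nonneg_left h₁ hτ.le
    simp only [hΨ, sub_self, norm_zero]
    nlinarith [norm_nonneg (w - z)]
  obtain ⟨w, hw⟩ := hcont.exists_forall_le' z hcoer
  have hmin : IsLocalMin Ψ w := Eventually.of_forall hw
  have h₀ := hmin.hasFDerivAt_eq_zero (hd w)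
  have h₁ : inner ℝ (τ • g w + (w - z)) (τ • g w + (w - z)) = (0 : ℝ) :=
    DFunLike.congr_fun h₀ (τ • g w + (w - z))
  refine ⟨w, ?_⟩
  have h₂ := inner_self_eq_zero.1 h₁
  rw [← sub_eq_zero, ← h₂]
  abel

/-- Solutions of the resolvent equation depend on the datum in a nonexpansive way. -/
theorem norm_resolvent_sub_le {Φ : H → ℝ} {g : H → H} {τ : ℝ}
    (hg : ∀ x, g x ∈ subdifferential Φ x) (hτ : 0 ≤ τ) (w₁ w₂ : H) :
    ‖w₁ - w₂‖ ≤ ‖(w₁ + τ • g w₁) - (w₂ + τ • g w₂)‖ := by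
  have h₁ := inner_sub_nonneg_of_mem_subdifferential (hg w₁) (hg w₂)
  have h₂ : (w₁ + τ • g w₁) - (w₂ + τ • g w₂) = (w₁ - w₂) + τ • (g w₁ - g w₂) := by
    rw [smul_sub]
    abel
  have h₃ : ‖w₁ - w₂‖ * ‖w₁ - w₂‖
      ≤ ‖(w₁ + τ • g w₁) - (w₂ + τ • g w₂)‖ * ‖w₁ - w₂‖ := by
    refine le_trans ?_ (real_inner_le_norm _ _)
    rw [h₂, inner_add_left, real_inner_smul_left, real_inner_self_eq_norm_mul_norm]
    nlinarith
  rcases (norm_nonneg (w₁ - w₂)).eq_or_lt with h | h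
  · rw [← h]
    exact norm_nonneg _
  · exact le_of_mul_le_mul_right h₃ h

/-- If `Φ` is within `δ` below `f`, the subgradient of `Φ` at the resolvent point of `x` is
almost no longer than any subgradient of `f` at `x` itself. -/
theorem norm_sq_resolvent_subgradient_le {Φ f : H → ℝ} {τ δ : ℝ} {w g p : H}
    (hτ : 0 < τ) (hΦ : ∀ x, Φ x ≤ f x) (hf : ∀ x, f x - δ ≤ Φ x)
    (hg : g ∈ subdifferential Φ w) (hp : p ∈ subdifferential f (w + τ • g)) :
    ‖g‖ ^ 2 ≤ ‖p‖ ^ 2 + 2 * (δ / τ) := by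
  have h₁ := hg (w + τ • g)
  have h₂ := hp w
  rw [add_sub_cancel_left, real_inner_smul_right, real_inner_self_eq_norm_sq] at h₁
  rw [sub_add_cancel_left, inner_neg_right, real_inner_smul_right] at h₂
  have h₃ := hΦ (w + τ • g)
  have h₄ := hf w
  have h₅ : inner ℝ p g ≤ (‖p‖ ^ 2 + ‖g‖ ^ 2) / 2 := by
    nlinarith [real_inner_le_norm p g, sq_nonneg (‖p‖ - ‖g‖)]
  have h₆ : τ * ‖g‖ ^ 2 ≤ τ * ((‖p‖ ^ 2 + ‖g‖ ^ 2) / 2) + δ := by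
    nlinarith [mul_le_mul_of_nonneg_left h₅ hτ.le]
  have h₇ : ‖g‖ ^ 2 ≤ (‖p‖ ^ 2 + ‖g‖ ^ 2) / 2 + δ / τ := by
    rw [← mul_le_mul_iff_right₀ hτ, mul_add, mul_div_cancel₀ _ hτ.ne']
    exact h₆
  linarith

end Resolvent

section Semicontinuity

variable {ι : Type*} [Fintype ι] [Nonempty ι]
variable {H : Type*} [NormedAddCommGroup H] [InnerProductSpace ℝ H] [FiniteDimensional ℝ H]

/-- Any bound on the subgradients `g i` of uniform approximations of `maxInner a`, at converging
base points, is inherited by the minimal subgradient at the limit point: by compactness the `g i`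
accumulate at a subgradient of `maxInner a`. -/
theorem norm_extendedGradient_le_of_tendsto (a : ι → H) {κ : Type*} {l : Filter κ} [l.NeBot]
    {h : κ → H → ℝ} {δ : κ → ℝ} {x g : κ → H} {x₀ : H} {M : ℝ} (hδ : Tendsto δ l (𝓝 0))
    (hh : ∀ᶠ i in l, ∀ y, |h i y - maxInner a y| ≤ δ i) (hx : Tendsto x l (𝓝 x₀))
    (hmem : ∀ᶠ i in l, g i ∈ subdifferential (h i) (x i)) (hM : ∀ᶠ i in l, ‖g i‖ ≤ M) :
    ‖extendedGradient (maxInner a) x₀‖ ≤ M := by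
  have : ProperSpace H := FiniteDimensional.proper_real H
  have : CompleteSpace H := FiniteDimensional.complete ℝ H
  set U := Ultrafilter.of l with hU
  have hUl : (U : Filter κ) ≤ l := Ultrafilter.of_le l
  have hball : (U.map g : Filter H) ≤ 𝓟 (Metric.closedBall 0 M) := by
    rw [le_principal_iff]
    exact (hM.filter_mono hUl).mono fun i hi => by simpa using hi
  obtain ⟨g₀, hg₀, hlim⟩ := (isCompact_closedBall (0 : H) M).ultrafilter_le_nhds _ hball
  have hdist : ∀ (y : κ → H) (y₀ : H), Tendsto y U (𝓝 y₀) →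
      Tendsto (fun i => h i (y i)) U (𝓝 (maxInner a y₀)) := by
    intro y y₀ hy
    have h₁ : Tendsto (fun i => h i (y i) - maxInner a (y i)) U (𝓝 0) :=
      squeeze_zero_norm' ((hh.filter_mono hUl).mono fun i hi => hi (y i)) (hδ.mono_left hUl)
    simpa using h₁.add (((continuous_maxInner a).tendsto y₀).comp hy)
  have hmem₀ : g₀ ∈ subdifferential (maxInner a) x₀ :=
    mem_subdifferential_of_tendsto (l := (U : Filter κ)) (fun y => hdist _ y tendsto_const_nhds)
      (hx.mono_left hUl) (hdist x x₀ (hx.mono_left hUl)) hlim (hmem.filter_mono hUl)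
  exact ((extendedGradient_spec ⟨g₀, hmem₀⟩).2 g₀ hmem₀).trans (by simpa using hg₀)

theorem lowerSemicontinuous_norm_extendedGradient (a : ι → H) :
    LowerSemicontinuous fun z => ‖extendedGradient (maxInner a) z‖ := by
  have : CompleteSpace H := FiniteDimensional.complete ℝ H
  intro x M hM
  by_contra hcon
  rw [not_eventually] at hcon
  have : (𝓝 x ⊓ 𝓟 {z | ¬ M < ‖extendedGradient (maxInner a) z‖}).NeBot :=
    frequently_mem_iff_neBot.1 hcon
  refine not_le.2 hM (norm_extendedGradient_le_of_tendsto a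
    (l := 𝓝 x ⊓ 𝓟 {z | ¬ M < ‖extendedGradient (maxInner a) z‖}) (δ := fun _ => 0)
    (h := fun _ => maxInner a) (x := id) (g := extendedGradient (maxInner a))
    tendsto_const_nhds (by simp) inf_le_left
    (Eventually.of_forall fun z =>
      (extendedGradient_spec (subdifferential_maxInner_nonempty a z)).1) ?_)
  filter_upwards [mem_inf_of_right (mem_principal_self _)] with z hz
  exact not_lt.1 hz

/-- Pointwise lower bound for the weighted squared Gibbs means as the temperature vanishes. -/
theorem ofReal_norm_sq_extendedGradient_le_liminf (a : ι → H) {κ : Type*} {l : Filter κ}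
    {ε : κ → ℝ} {x : κ → H} {x₀ : H} (hε : Tendsto ε l (𝓝[>] 0)) (hx : Tendsto x l (𝓝 x₀))
    {c : ℝ} (hc : 0 ≤ c) :
    ENNReal.ofReal (c * ‖extendedGradient (maxInner a) x₀‖ ^ 2)
      ≤ liminf (fun i => ENNReal.ofReal (c * ‖gibbsMean a (ε i) (x i)‖ ^ 2)) l := by
  by_contra! hcon
  obtain ⟨b, hb₁, hb₂⟩ := exists_between hcon
  have hbtop : b ≠ ⊤ := (hb₂.trans ENNReal.ofReal_lt_top).ne
  have hfreq := frequently_lt_of_liminf_lt (h := hb₁)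
  set s := {i | ENNReal.ofReal (c * ‖gibbsMean a (ε i) (x i)‖ ^ 2) < b} with hs
  have : (l ⊓ 𝓟 s).NeBot := frequently_mem_iff_neBot.1 hfreq
  have hb₃ : b.toReal < c * ‖extendedGradient (maxInner a) x₀‖ ^ 2 := by
    rwa [ENNReal.lt_ofReal_iff_toReal_lt hbtop] at hb₂
  have hcpos : 0 < c := by
    rcases hc.eq_or_lt with rfl | h
    · rw [zero_mul] at hb₃
      exact absurd hb₃ (not_lt.2 ENNReal.toReal_nonneg)
    · exact h
  have hpos : ∀ᶠ i in l ⊓ 𝓟 s, 0 < ε i :=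
    (hε.eventually self_mem_nhdsWithin).filter_mono inf_le_left
  have hε₀ : Tendsto ε (l ⊓ 𝓟 s) (𝓝 0) :=
    (hε.mono_left inf_le_left).mono_right nhdsWithin_le_nhds
  have key : ‖extendedGradient (maxInner a) x₀‖ ≤ √(b.toReal / c) := by
    refine norm_extendedGradient_le_of_tendsto a (l := l ⊓ 𝓟 s)
      (h := fun i => softMax a (ε i)) (δ := fun i => ε i * Real.log (Fintype.card ι))
      (g := fun i => gibbsMean a (ε i) (x i))
      (by simpa using hε₀.mul_const (Real.log (Fintype.card ι)))
      (hpos.mono fun i hi y => abs_softMax_sub_maxInner_le a (ε i) y hi)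
      (hx.mono_left inf_le_left)
      (hpos.mono fun i hi => gibbsMean_mem_subdifferential a (ε i) (x i) hi) ?_
    filter_upwards [mem_inf_of_right (mem_principal_self s)] with i hi
    refine Real.le_sqrt_of_sq_le ?_
    rw [le_div_iff₀ hcpos, mul_comm]
    have h₁ : ENNReal.ofReal (c * ‖gibbsMean a (ε i) (x i)‖ ^ 2) < b := hi
    rw [ENNReal.ofReal_lt_iff_lt_toReal (by positivity) hbtop] at h₁
    exact h₁.le
  have h₂ := pow_le_pow_left₀ (norm_nonneg _) key 2
  rw [Real.sq_sqrt (by positivity), le_div_iff₀ hcpos, mul_comm] at h₂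
  exact not_lt.2 h₂ hb₃

end Semicontinuity

/-! ### Absolutely continuous and `H¹` curves -/

section AbsoluteContinuity

open AbsolutelyContinuousOnInterval

theorem absolutelyContinuousOnInterval_of_dist_le {X Y : Type*} [PseudoMetricSpace X]
    [PseudoMetricSpace Y] {f : ℝ → X} {g : ℝ → Y} {a b K : ℝ}
    (hg : AbsolutelyContinuousOnInterval g a b)
    (h : ∀ x ∈ uIcc a b, ∀ y ∈ uIcc a b, dist (f x) (f y) ≤ K * dist (g x) (g y)) :
    AbsolutelyContinuousOnInterval f a b := by
  have hlim : Tendsto (fun E : ℕ × (ℕ → ℝ × ℝ) =>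
      K * ∑ i ∈ Finset.range E.1, dist (g (E.2 i).1) (g (E.2 i).2))
      (totalLengthFilter ⊓ 𝓟 (disjWithin a b)) (𝓝 0) := by
    simpa using Tendsto.const_mul K hg
  refine squeeze_zero' (Eventually.of_forall fun E => Finset.sum_nonneg fun i _ => dist_nonneg)
    ?_ hlim
  filter_upwards [mem_inf_of_right (mem_principal_self (disjWithin a b))] with E hE
  rw [Finset.mul_sum]
  exact Finset.sum_le_sum fun i hi => h _ (hE.1 i hi).1 _ (hE.1 i hi).2

variable {H : Type*} [NormedAddCommGroup H] [NormedSpace ℝ H]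

theorem absolutelyContinuousOnInterval_primitive {V : ℝ → H} {a b : ℝ}
    (hV : IntervalIntegrable V volume a b) :
    AbsolutelyContinuousOnInterval (fun t => ∫ s in a..t, V s) a b := by
  refine absolutelyContinuousOnInterval_of_dist_le (K := 1)
    (hV.norm.absolutelyContinuousOnInterval_intervalIntegral left_mem_uIcc) fun x hx y hy => ?_
  have hsub : ∀ z ∈ uIcc a b, uIcc a z ⊆ uIcc a b := fun z hz => uIcc_subset_uIcc_left hz
  have hx' : IntervalIntegrable V volume a x := hV.mono_set (hsub x hx)
  have hy' : IntervalIntegrable V volume a y := hV.mono_set (hsub y hy)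
  rw [one_mul, dist_eq_norm, Real.dist_eq, intervalIntegral.integral_interval_sub_left hx' hy',
    intervalIntegral.integral_interval_sub_left hx'.norm hy'.norm]
  exact intervalIntegral.norm_integral_le_abs_integral_norm

end AbsoluteContinuity

section Sobolev

variable {H : Type*} [NormedAddCommGroup H] [NormedSpace ℝ H]

/-- The curve `Z` is of class `H¹` on `[a, b]`: it is absolutely continuous and its almost
everywhere derivative is square integrable. -/
structure IsSobolev (Z : ℝ → H) (a b : ℝ) : Prop where
  ac : AbsolutelyContinuousOnInterval Z a b
  memLp : MemLp (deriv Z) 2 (volume.restrict (Icc a b))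

theorem ae_mem_Ioo (a b : ℝ) : ∀ᵐ t ∂volume.restrict (Icc a b), t ∈ Ioo a b := by
  rw [← restrict_Ioo_eq_restrict_Icc]
  exact ae_restrict_mem measurableSet_Ioo

theorem norm_deriv_le_of_dist_le {W Z : ℝ → H} {a b t : ℝ} (ht : t ∈ Ioo a b)
    (hW : DifferentiableAt ℝ W t) (hZ : DifferentiableAt ℝ Z t)
    (h : ∀ x ∈ Icc a b, ∀ y ∈ Icc a b, ‖W x - W y‖ ≤ ‖Z x - Z y‖) :
    ‖deriv W t‖ ≤ ‖deriv Z t‖ := by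
  have h₁ := (hasDerivAt_iff_tendsto_slope.1 hW.hasDerivAt).norm
  have h₂ := (hasDerivAt_iff_tendsto_slope.1 hZ.hasDerivAt).norm
  refine le_of_tendsto_of_tendsto h₁ h₂ ?_
  filter_upwards [mem_nhdsWithin_of_mem_nhds (Icc_mem_nhds ht.1 ht.2)] with s hs
  simp only [slope, vsub_eq_sub, norm_smul]
  exact mul_le_mul_of_nonneg_left (h s hs t (Ioo_subset_Icc_self ht)) (norm_nonneg _)

variable {Z W : ℝ → H} {a b : ℝ}

namespace IsSobolev

theorem continuousOn (hZ : IsSobolev Z a b) (hab : a ≤ b) : ContinuousOn Z (Icc a b) := by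
  have := hZ.ac.continuousOn
  rwa [uIcc_of_le hab] at this

theorem integrable_deriv (hZ : IsSobolev Z a b) :
    Integrable (deriv Z) (volume.restrict (Icc a b)) := hZ.memLp.integrable (by norm_num)

theorem const (v : H) (a b : ℝ) : IsSobolev (fun _ => v) a b := by
  refine ⟨LipschitzOnWith.absolutelyContinuousOnInterval (K := 0)
    (LipschitzWith.const v).lipschitzOnWith, ?_⟩
  simp

end IsSobolev

variable [FiniteDimensional ℝ H]

theorem ae_hasDerivAt_of_ac (hab : a ≤ b) (hZ : AbsolutelyContinuousOnInterval Z a b) :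
    ∀ᵐ t ∂volume.restrict (Icc a b), HasDerivAt Z (deriv Z t) t := by
  rw [ae_restrict_iff' measurableSet_Icc]
  filter_upwards [hZ.boundedVariationOn.ae_differentiableAt_of_mem_uIcc] with t ht hmem
  exact (ht (by rwa [uIcc_of_le hab])).hasDerivAt

namespace IsSobolev

theorem ae_hasDerivAt (hZ : IsSobolev Z a b) (hab : a ≤ b) :
    ∀ᵐ t ∂volume.restrict (Icc a b), HasDerivAt Z (deriv Z t) t :=
  ae_hasDerivAt_of_ac hab hZ.ac

/-- A curve dominated by an `H¹` curve, in the sense that its increments are no longer, is `H¹`. -/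
theorem of_norm_sub_le (hZ : IsSobolev Z a b) (hab : a ≤ b)
    (h : ∀ x ∈ Icc a b, ∀ y ∈ Icc a b, ‖W x - W y‖ ≤ ‖Z x - Z y‖) :
    IsSobolev W a b ∧ ∀ᵐ t ∂volume.restrict (Icc a b), ‖deriv W t‖ ≤ ‖deriv Z t‖ := by
  have : CompleteSpace H := FiniteDimensional.complete ℝ H
  have hac : AbsolutelyContinuousOnInterval W a b := by
    refine absolutelyContinuousOnInterval_of_dist_le (K := 1) hZ.ac ?_
    rw [uIcc_of_le hab]
    intro x hx y hy
    rw [one_mul, dist_eq_norm, dist_eq_norm]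
    exact h x hx y hy
  have hle : ∀ᵐ t ∂volume.restrict (Icc a b), ‖deriv W t‖ ≤ ‖deriv Z t‖ := by
    filter_upwards [ae_mem_Ioo a b, hZ.ae_hasDerivAt hab, ae_hasDerivAt_of_ac hab hac]
      with t ht h₁ h₂
    exact norm_deriv_le_of_dist_le ht h₂.differentiableAt h₁.differentiableAt h
  exact ⟨⟨hac, hZ.memLp.mono (stronglyMeasurable_deriv W).aestronglyMeasurable hle⟩, hle⟩

theorem congr (hZ : IsSobolev Z a b) (hab : a ≤ b) (h : EqOn W Z (Icc a b)) :
    IsSobolev W a b :=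
  (hZ.of_norm_sub_le hab fun x hx y hy => by rw [h hx, h hy]).1

theorem add (hZ : IsSobolev Z a b) (hab : a ≤ b) (hW : IsSobolev W a b) :
    IsSobolev (fun t => Z t + W t) a b := by
  refine ⟨hZ.ac.fun_add hW.ac, (hZ.memLp.add hW.memLp).ae_eq ?_⟩
  filter_upwards [hZ.ae_hasDerivAt hab, hW.ae_hasDerivAt hab] with t h₁ h₂
  exact (h₁.add h₂).deriv.symm

/-- The product of an `H¹` curve with a Lipschitz function is `H¹`. -/
theorem smul_lipschitz (hZ : IsSobolev Z a b) (hab : a ≤ b) {φ : ℝ → ℝ} {K : NNReal}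
    (hφ : LipschitzOnWith K φ (Icc a b)) : IsSobolev (fun t => φ t • Z t) a b := by
  have : CompleteSpace H := FiniteDimensional.complete ℝ H
  have hφac : AbsolutelyContinuousOnInterval φ a b := by
    apply LipschitzOnWith.absolutelyContinuousOnInterval (K := K)
    rwa [uIcc_of_le hab]
  have hac : AbsolutelyContinuousOnInterval (fun t => φ t • Z t) a b := hφac.fun_smul hZ.ac
  obtain ⟨C, hC⟩ := isCompact_Icc.exists_bound_of_continuousOn hφ.continuousOn
  obtain ⟨D, hD⟩ := isCompact_Icc.exists_bound_of_continuousOn (hZ.continuousOn hab)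
  have hbound : MemLp (fun t => C * ‖deriv Z t‖ + K * D) 2 (volume.restrict (Icc a b)) :=
    (hZ.memLp.norm.const_mul C).add (memLp_const _)
  refine ⟨hac, hbound.mono (stronglyMeasurable_deriv _).aestronglyMeasurable ?_⟩
  filter_upwards [ae_mem_Ioo a b, hZ.ae_hasDerivAt hab, ae_hasDerivAt_of_ac hab hφac]
    with t ht h₁ h₂
  have ht' := Ioo_subset_Icc_self ht
  have hd := norm_deriv_le_of_lipschitzOn (Icc_mem_nhds ht.1 ht.2) hφ
  rw [(h₂.fun_smul h₁).deriv]
  refine (norm_add_le _ _).trans (le_trans ?_ (le_abs_self _))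
  rw [norm_smul, norm_smul]
  exact add_le_add (mul_le_mul_of_nonneg_right (hC t ht') (norm_nonneg _))
    (mul_le_mul hd (hD t ht') (norm_nonneg _) K.2)

theorem eq_add_integral (hZ : IsSobolev Z a b) (hab : a ≤ b) {t : ℝ} (ht : t ∈ Icc a b) :
    Z t = Z a + ∫ s in a..t, deriv Z s := by
  have : CompleteSpace H := FiniteDimensional.complete ℝ H
  have hi : IntervalIntegrable (deriv Z) volume a b := by
    rw [intervalIntegrable_iff_integrableOn_Icc_of_le hab]
    exact hZ.integrable_deriv
  have hac : AbsolutelyContinuousOnInterval (fun t => Z t - ∫ s in a..t, deriv Z s) a b :=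
    hZ.ac.fun_sub (absolutelyContinuousOnInterval_primitive hi)
  have h₀ : ∀ᵐ t, t ∈ uIcc a b → HasDerivAt (fun t => Z t - ∫ s in a..t, deriv Z s) 0 t := by
    filter_upwards [hZ.ac.boundedVariationOn.ae_differentiableAt_of_mem_uIcc,
      hi.ae_hasDerivAt_integral] with t h₁ h₂ hmem
    simpa using (h₁ hmem).hasDerivAt.fun_sub (h₂ hmem a left_mem_uIcc)
  obtain ⟨C, hC⟩ := hac.const_of_ae_hasDerivAt_zero h₀
  have e₁ := hC a left_mem_uIcc
  have e₂ := hC t (by rwa [uIcc_of_le hab])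
  simp only [intervalIntegral.integral_same, sub_zero] at e₁
  rw [← e₁] at e₂
  rw [← e₂]
  abel

/-- Primitives of square integrable functions are `H¹`. -/
theorem of_primitive (hab : a ≤ b) {V : ℝ → H}
    (hV : MemLp V 2 (volume.restrict (Icc a b)))
    (hZ : ∀ t ∈ Icc a b, Z t = Z a + ∫ s in a..t, V s) :
    IsSobolev Z a b ∧ ∀ᵐ t ∂volume.restrict (Icc a b), deriv Z t = V t := by
  have : CompleteSpace H := FiniteDimensional.complete ℝ H
  have hi : IntervalIntegrable V volume a b := by
    rw [intervalIntegrable_iff_integrableOn_Icc_of_le hab]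
    exact hV.integrable (by norm_num)
  have hac : AbsolutelyContinuousOnInterval Z a b := by
    refine absolutelyContinuousOnInterval_of_dist_le (K := 1)
      (absolutelyContinuousOnInterval_primitive hi) ?_
    rw [uIcc_of_le hab]
    intro x hx y hy
    rw [hZ x hx, hZ y hy, dist_add_left, one_mul]
  have hd : ∀ᵐ t ∂volume.restrict (Icc a b), deriv Z t = V t := by
    rw [← restrict_Ioo_eq_restrict_Icc, ae_restrict_iff' measurableSet_Ioo]
    filter_upwards [hi.ae_hasDerivAt_integral] with t ht hmem
    have hmem' : t ∈ uIcc a b := by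
      rw [uIcc_of_le hab]
      exact Ioo_subset_Icc_self hmem
    refine (((ht hmem' a left_mem_uIcc).const_add (Z a)).congr_of_eventuallyEq ?_).deriv
    filter_upwards [Ioo_mem_nhds hmem.1 hmem.2] with s hs
    exact hZ s (Ioo_subset_Icc_self hs)
  exact ⟨⟨hac, hV.ae_eq (hd.mono fun t ht => ht.symm)⟩, hd⟩

end IsSobolev

end Sobolev

theorem isH1_iff_isSobolev {E : Type*} [NormedAddCommGroup E] [InnerProductSpace ℝ E]
    [FiniteDimensional ℝ E] {t₀ t₁ : ℝ} (h : t₀ ≤ t₁) (X : C(Icc t₀ t₁, E)) :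
    IsH1 h X ↔ IsSobolev (pos h X) t₀ t₁ :=
  ⟨fun ⟨_, hV, hX⟩ => (IsSobolev.of_primitive h hV hX).1,
    fun hX => ⟨_, hX.memLp, fun _ ht => hX.eq_add_integral h ht⟩⟩

/-! ### Weak lower semicontinuity of the kinetic energy -/

section WeakCompactness

/-- Weak compactness of balls of a Hilbert space, along a filter. Passing to an ultrafilter instead
of a subsequence avoids any separability. -/
theorem exists_ultrafilter_weak_limit {K : Type*} [NormedAddCommGroup K] [InnerProductSpace ℝ K]
    [CompleteSpace K] {κ : Type*} {l : Filter κ} [l.NeBot] {u : κ → K} {r : ℝ}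
    (hu : ∀ᶠ i in l, ‖u i‖ ≤ r) :
    ∃ (U : Ultrafilter κ) (v : K), (U : Filter κ) ≤ l ∧ ‖v‖ ≤ r ∧
      ∀ φ, Tendsto (fun i => inner ℝ (u i) φ) U (𝓝 (inner ℝ v φ)) := by
  set U := Ultrafilter.of l
  have hUl : (U : Filter κ) ≤ l := Ultrafilter.of_le l
  set D : κ → WeakDual ℝ K := fun i => StrongDual.toWeakDual (InnerProductSpace.toDual ℝ K (u i))
  set B := WeakDual.toStrongDual ⁻¹' Metric.closedBall (0 : StrongDual ℝ K) r
  have hball : (U.map D : Filter (WeakDual ℝ K)) ≤ 𝓟 B := by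
    rw [le_principal_iff]
    refine (hu.filter_mono hUl).mono fun i hi => ?_
    have : ‖InnerProductSpace.toDual ℝ K (u i)‖ ≤ r := by simpa using hi
    simpa [B, D] using this
  obtain ⟨f, hf, hlim⟩ := (WeakDual.isCompact_closedBall (0 : StrongDual ℝ K) r).ultrafilter_le_nhds
    _ hball
  refine ⟨U, (InnerProductSpace.toDual ℝ K).symm (WeakDual.toStrongDual f), hUl, ?_, fun φ => ?_⟩
  · rw [LinearIsometryEquiv.norm_map]
    simpa [B] using hf
  · rw [InnerProductSpace.toDual_symm_apply]
    exact ((WeakDual.eval_continuous φ).tendsto f).comp hlim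

variable {H : Type*} [NormedAddCommGroup H] [InnerProductSpace ℝ H] {a b : ℝ}

theorem memLp_smul_of_continuousOn {φ : ℝ → ℝ} {V : ℝ → H} (hφ : ContinuousOn φ (Icc a b))
    (hV : MemLp V 2 (volume.restrict (Icc a b))) :
    MemLp (fun t => φ t • V t) 2 (volume.restrict (Icc a b)) := by
  obtain ⟨C, hC⟩ := isCompact_Icc.exists_bound_of_continuousOn hφ
  refine MemLp.of_le_mul (c := C) hV
    ((hφ.aestronglyMeasurable measurableSet_Icc).smul hV.aestronglyMeasurable) ?_
  filter_upwards [ae_restrict_mem measurableSet_Icc] with t ht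
  rw [norm_smul]
  exact mul_le_mul_of_nonneg_right (hC t ht) (norm_nonneg _)

theorem norm_toLp_sq {w : ℝ → H} {μ : Measure ℝ} (hw : MemLp w 2 μ) :
    ‖hw.toLp w‖ ^ 2 = ∫ t, ‖w t‖ ^ 2 ∂μ := by
  rw [← real_inner_self_eq_norm_sq, L2.inner_def]
  refine integral_congr_ae ?_
  filter_upwards [hw.coeFn_toLp] with t ht
  rw [ht, real_inner_self_eq_norm_sq]

/-- Increments of the primitive of `φ w` are values of continuous linear functionals of `w ∈ L²`,
hence pass to weak limits. -/
theorem inner_toLp_indicator [CompleteSpace H] {w : ℝ → H} {φ : ℝ → ℝ}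
    (hφ : ContinuousOn φ (Icc a b))
    (hw : MemLp w 2 (volume.restrict (Icc a b))) {t : ℝ} (ht : t ∈ Icc a b) (e : H)
    (he : MemLp ((Ioc a t).indicator fun s => φ s • e) 2 (volume.restrict (Icc a b))) :
    inner ℝ (hw.toLp w) (he.toLp _) = inner ℝ (∫ s in a..t, φ s • w s) e := by
  have hsub : Ioc a t ⊆ Icc a b := fun s hs => ⟨hs.1.le, hs.2.trans ht.2⟩
  have hint : Integrable (fun s => φ s • w s) (volume.restrict (Ioc a t)) :=
    ((memLp_smul_of_continuousOn hφ hw).integrable (by norm_num)).mono_measure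
      (Measure.restrict_mono hsub le_rfl)
  rw [L2.inner_def, intervalIntegral.integral_of_le ht.1, real_inner_comm,
    ← integral_inner hint e]
  have h₁ : ∀ᵐ s ∂volume.restrict (Icc a b), inner ℝ (hw.toLp w s) (he.toLp _ s)
      = (Ioc a t).indicator (fun s => inner ℝ e (φ s • w s)) s := by
    filter_upwards [hw.coeFn_toLp, he.coeFn_toLp] with s h₁ h₂
    rw [h₁, h₂]
    by_cases hs : s ∈ Ioc a t
    · simp [hs, real_inner_smul_right, real_inner_comm]
    · simp [hs]
  rw [integral_congr_ae h₁, integral_indicator measurableSet_Ioc,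
    Measure.restrict_restrict measurableSet_Ioc, inter_eq_left.2 hsub]

/-- Weak lower semicontinuity of the weighted kinetic energy `∫ ρ |Z'|²` under pointwise
convergence, with closedness of `H¹`: the functions `√ρ Z_i'` accumulate weakly in `L²` at some
`v`, and `Z` is a primitive of `v / √ρ`. -/
theorem isSobolev_and_kinetic_le_of_tendsto [FiniteDimensional ℝ H] (hab : a ≤ b) {ρ : ℝ → ℝ}
    (hρ : ContinuousOn ρ (Icc a b)) (hρpos : ∀ t ∈ Icc a b, 0 < ρ t) {κ : Type*} {l : Filter κ}
    [l.NeBot] {Y : κ → ℝ → H} {Z : ℝ → H} {M : ℝ} (hY : ∀ i, IsSobolev (Y i) a b)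
    (hM : ∀ᶠ i in l, ∫ t in Icc a b, ρ t * ‖deriv (Y i) t‖ ^ 2 ≤ M)
    (hlim : ∀ t ∈ Icc a b, Tendsto (fun i => Y i t) l (𝓝 (Z t))) :
    IsSobolev Z a b ∧ ∫ t in Icc a b, ρ t * ‖deriv Z t‖ ^ 2 ≤ M := by
  have : CompleteSpace H := FiniteDimensional.complete ℝ H
  have hr : ContinuousOn (fun t => √(ρ t)) (Icc a b) := hρ.sqrt
  have hrpos : ∀ t ∈ Icc a b, 0 < √(ρ t) := fun t ht => Real.sqrt_pos.2 (hρpos t ht)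
  have hr' : ContinuousOn (fun t => (√(ρ t))⁻¹) (Icc a b) := hr.inv₀ fun t ht => (hrpos t ht).ne'
  have hmem : ∀ i, MemLp (fun t => √(ρ t) • deriv (Y i) t) 2 (volume.restrict (Icc a b)) :=
    fun i => memLp_smul_of_continuousOn hr (hY i).memLp
  have hsq : ∀ t ∈ Icc a b, ∀ V : H, ‖√(ρ t) • V‖ ^ 2 = ρ t * ‖V‖ ^ 2 := fun t ht V => by
    rw [norm_smul, mul_pow, Real.norm_eq_abs, sq_abs, Real.sq_sqrt (hρpos t ht).le]
  have hnorm : ∀ i, ‖(hmem i).toLp _‖ ^ 2 = ∫ t in Icc a b, ρ t * ‖deriv (Y i) t‖ ^ 2 := by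
    intro i
    rw [norm_toLp_sq]
    exact setIntegral_congr_fun measurableSet_Icc fun t ht => hsq t ht _
  obtain ⟨i₀, hi₀⟩ := hM.exists
  have hM₀ : 0 ≤ M := le_trans (by rw [← hnorm]; positivity) hi₀
  obtain ⟨U, v, hUl, hv, hweak⟩ := exists_ultrafilter_weak_limit (l := l)
    (u := fun i => (hmem i).toLp _) (r := √M) (hM.mono fun i hi => Real.le_sqrt_of_sq_le (by
      rwa [hnorm]))
  have hvmem : MemLp (v : ℝ → H) 2 (volume.restrict (Icc a b)) := Lp.memLp v
  have hvLp : hvmem.toLp _ = v := Lp.toLp_coeFn v hvmem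
  have hprim : ∀ t ∈ Icc a b, Z t = Z a + ∫ s in a..t, (√(ρ s))⁻¹ • v s := by
    intro t ht
    rw [← sub_eq_iff_eq_add']
    refine ext_inner_right ℝ fun e => ?_
    have he : MemLp ((Ioc a t).indicator fun s => (√(ρ s))⁻¹ • e) 2
        (volume.restrict (Icc a b)) :=
      (memLp_smul_of_continuousOn hr' (memLp_const e)).indicator measurableSet_Ioc
    have h₁ := hweak (he.toLp _)
    rw [← hvLp, inner_toLp_indicator hr' hvmem ht e he] at h₁
    have h₂ : Tendsto (fun i => inner ℝ (Y i t - Y i a) e) U (𝓝 (inner ℝ (Z t - Z a) e)) :=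
      (((hlim t ht).mono_left hUl).sub ((hlim a (left_mem_Icc.2 hab)).mono_left hUl)).inner
        tendsto_const_nhds
    refine tendsto_nhds_unique h₂ (h₁.congr fun i => ?_)
    rw [inner_toLp_indicator hr' (hmem i) ht e he, (hY i).eq_add_integral hab ht,
      add_sub_cancel_left]
    congr 1
    refine intervalIntegral.integral_congr fun s hs => ?_
    rw [uIcc_of_le ht.1] at hs
    exact inv_smul_smul₀ (hrpos s ⟨hs.1, hs.2.trans ht.2⟩).ne' _
  obtain ⟨hZ, hd⟩ := IsSobolev.of_primitive hab (memLp_smul_of_continuousOn hr' hvmem) hprim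
  refine ⟨hZ, ?_⟩
  have h₁ : ∫ t in Icc a b, ρ t * ‖deriv Z t‖ ^ 2 = ‖v‖ ^ 2 := by
    rw [← hvLp, norm_toLp_sq]
    refine integral_congr_ae ?_
    filter_upwards [hd, ae_restrict_mem measurableSet_Icc] with t ht hmem
    rw [ht, ← hsq t hmem, smul_inv_smul₀ (hrpos t hmem).ne']
  rw [h₁]
  calc ‖v‖ ^ 2 ≤ √M ^ 2 := pow_le_pow_left₀ (norm_nonneg _) hv 2
    _ = M := Real.sq_sqrt hM₀

end WeakCompactness

/-! ### Expansion of the action -/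

section Weights

variable {E : Type*} [NormedAddCommGroup E] {a b : ℝ}

theorem integrableOn_mul_norm_sq {ρ : ℝ → ℝ}
    {V : ℝ → E} (hρ : ContinuousOn ρ (Icc a b))
    (hV : MemLp V 2 (volume.restrict (Icc a b))) :
    IntegrableOn (fun t => ρ t * ‖V t‖ ^ 2) (Icc a b) := by
  have h : IntegrableOn (fun t => ‖V t‖ ^ 2) (Icc a b) := hV.norm.integrable_sq
  exact h.continuousOn_mul hρ isCompact_Icc

theorem continuousOn_weight {β : ℝ → ℝ} (hβ : ContDiffOn ℝ ∞ β (Ioi 0)) (ha : 0 < a) :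
    ContinuousOn β (Icc a b) ∧ ContinuousOn (deriv β) (Icc a b) := by
  have hsub : Icc a b ⊆ Ioi 0 := fun t ht => ha.trans_le ht.1
  exact ⟨hβ.continuousOn.mono hsub,
    (hβ.continuousOn_deriv_of_isOpen isOpen_Ioi (by simp)).mono hsub⟩

theorem absolutelyContinuousOnInterval_weight {β : ℝ → ℝ} (hβ : ContDiffOn ℝ ∞ β (Ioi 0))
    (ha : 0 < a) (hab : a ≤ b) : AbsolutelyContinuousOnInterval β a b := by
  refine ContDiffOn.absolutelyContinuousOnInterval ((hβ.of_le (by simp)).mono ?_)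
  rw [uIcc_of_le hab]
  exact fun t ht => ha.trans_le ht.1

theorem integrableOn_slope (ha : 0 < a) {β : ℝ → ℝ} (hβ : ContDiffOn ℝ ∞ β (Ioi 0)) {g : E → E}
    {Z : ℝ → E}
    {R : ℝ} (hR : ∀ z, ‖g z‖ ≤ R)
    (hs : AEStronglyMeasurable (fun t => ‖g (Z t)‖) (volume.restrict (Icc a b))) :
    IntegrableOn (fun t => β t / (4 * t ^ 2) * ‖g (Z t)‖ ^ 2) (Icc a b) := by
  have h₁ : MemLp (fun t => ‖g (Z t)‖) 2 (volume.restrict (Icc a b)) :=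
    MemLp.of_bound hs R (Eventually.of_forall fun t => by simpa using hR (Z t))
  simpa using integrableOn_mul_norm_sq (V := fun t => ‖g (Z t)‖)
    ((continuousOn_weight hβ ha).1.div (continuousOn_const.mul (continuousOn_id.pow 2)) fun t ht =>
      (mul_pos four_pos (pow_pos (ha.trans_le ht.1) 2)).ne') h₁

end Weights

section Energy

variable {H : Type*} [NormedAddCommGroup H] [InnerProductSpace ℝ H]

/-- Chain rule for a subgradient: where both `Z` and `Φ ∘ Z` are differentiable,
`s ↦ Φ (Z s) - ⟪g, Z s⟫` has a minimum at `t`, hence a vanishing derivative. -/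
theorem deriv_comp_eq_inner {Φ : H → ℝ} {Z : ℝ → H} {t : ℝ} {g V : H} (hZ : HasDerivAt Z V t)
    (hg : g ∈ subdifferential Φ (Z t)) (hΦ : DifferentiableAt ℝ (fun s => Φ (Z s)) t) :
    deriv (fun s => Φ (Z s)) t = inner ℝ g V := by
  have hmin : IsLocalMin (fun s => Φ (Z s) - inner ℝ g (Z s)) t := by
    refine Eventually.of_forall fun s => ?_
    have := hg (Z s)
    rw [inner_sub_right] at this
    linarith
  have hd : HasDerivAt (fun s => Φ (Z s) - inner ℝ g (Z s))
      (deriv (fun s => Φ (Z s)) t - inner ℝ g V) t := by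
    have h₁ : HasDerivAt (fun s => inner ℝ g (Z s)) (inner ℝ g V) t := by
      simpa using (hasDerivAt_const t g).inner ℝ hZ
    exact hΦ.hasDerivAt.fun_sub h₁
  exact sub_eq_zero.1 (hmin.hasDerivAt_eq_zero hd)

theorem id_mem_subdifferential_half_norm_sq (z : H) :
    z ∈ subdifferential (fun x : H => ‖x‖ ^ 2 / 2) z := by
  intro y
  have h : inner ℝ z y ≤ (‖z‖ ^ 2 + ‖y‖ ^ 2) / 2 := by
    nlinarith [real_inner_le_norm z y, sq_nonneg (‖z‖ - ‖y‖)]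
  simp only [inner_sub_right, real_inner_self_eq_norm_sq]
  linarith

variable [FiniteDimensional ℝ H] {a b : ℝ} {Z : ℝ → H}

/-- Integration by parts for the derivative of a convex function along an `H¹` curve. -/
theorem integrable_and_integral_mul_inner_subgradient (hab : a ≤ b) (hZ : IsSobolev Z a b)
    {Φ : H → ℝ} {g : ℝ → H} (hΦ : AbsolutelyContinuousOnInterval (fun t => Φ (Z t)) a b)
    (hg : ∀ t, g t ∈ subdifferential Φ (Z t)) {w : ℝ → ℝ}
    (hw : AbsolutelyContinuousOnInterval w a b) :
    IntegrableOn (fun t => w t * inner ℝ (g t) (deriv Z t)) (Icc a b) ∧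
      ∫ t in Icc a b, w t * inner ℝ (g t) (deriv Z t)
        = w b * Φ (Z b) - w a * Φ (Z a) - ∫ t in Icc a b, deriv w t * Φ (Z t) := by
  have hae : ∀ᵐ t ∂volume.restrict (Icc a b),
      w t * deriv (fun s => Φ (Z s)) t = w t * inner ℝ (g t) (deriv Z t) := by
    filter_upwards [hZ.ae_hasDerivAt hab, ae_hasDerivAt_of_ac hab hΦ] with t h₁ h₂
    rw [deriv_comp_eq_inner h₁ (hg t) h₂.differentiableAt]
  have hint : IntegrableOn (fun t => w t * deriv (fun s => Φ (Z s)) t) (Icc a b) := by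
    rw [← intervalIntegrable_iff_integrableOn_Icc_of_le hab]
    exact hΦ.intervalIntegrable_deriv.continuousOn_mul hw.continuousOn
  refine ⟨hint.congr hae, ?_⟩
  rw [← integral_congr_ae hae, integral_Icc_eq_integral_Ioc, integral_Icc_eq_integral_Ioc,
    ← intervalIntegral.integral_of_le hab, ← intervalIntegral.integral_of_le hab]
  exact hw.integral_mul_deriv_eq_deriv_mul hΦ

/-- The part of the action that depends only on the values of the curve, and not on its velocity
or on the subgradients. Here `m` stands for `z ↦ ⟪g z, z⟫`. -/
def crossTerm (β : ℝ → ℝ) (Φ m : H → ℝ) (Z : ℝ → H) (a b : ℝ) : ℝ :=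
  (b * β b * (‖Z b‖ ^ 2 / 2) + β b * Φ (Z b)) - (a * β a * (‖Z a‖ ^ 2 / 2) + β a * Φ (Z a))
    + ∫ t in Icc a b, ((-(β t / 4) - t * deriv β t / 2) * ‖Z t‖ ^ 2
      + β t / (2 * t) * m (Z t) - deriv β t * Φ (Z t))

/-- Expansion of the action of an `H¹` curve, written in the variable `Z t = X t / t`. The mixed
terms integrate by parts, because `⟪g (Z t), Z' t⟫` is the derivative of `Φ (Z t)`. -/
theorem integrable_and_action_expansion (ha : 0 < a) (hab : a ≤ b) (hZ : IsSobolev Z a b)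
    {β : ℝ → ℝ} (hβ : ContDiffOn ℝ ∞ β (Ioi 0)) {Φ m : H → ℝ} {g : H → H} {R : NNReal}
    (hg : ∀ z, g z ∈ subdifferential Φ z) (hR : ∀ z, ‖g z‖ ≤ R)
    (hm : ∀ z, inner ℝ (g z) z = m z) (hmc : Continuous m)
    (hs : AEStronglyMeasurable (fun t => ‖g (Z t)‖) (volume.restrict (Icc a b))) :
    IntegrableOn (fun t => ‖t • deriv Z t + (1 / 2 : ℝ) • Z t + (1 / (2 * t)) • g (Z t)‖ ^ 2
      * β t) (Icc a b) ∧
    ∫ t in Icc a b, ‖t • deriv Z t + (1 / 2 : ℝ) • Z t + (1 / (2 * t)) • g (Z t)‖ ^ 2 * β t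
      = (∫ t in Icc a b, t ^ 2 * β t * ‖deriv Z t‖ ^ 2)
        + (∫ t in Icc a b, β t / (4 * t ^ 2) * ‖g (Z t)‖ ^ 2) + crossTerm β Φ m Z a b := by
  obtain ⟨hβc, hβ'c⟩ := continuousOn_weight (b := b) hβ ha
  have hpos : ∀ t ∈ Icc a b, 0 < t := fun t ht => ha.trans_le ht.1
  have hZc := hZ.continuousOn hab
  have hlip := lipschitzWith_of_bounded_subgradient hg hR
  have hidc : ContinuousOn (fun t : ℝ => t) (Icc a b) := continuousOn_id
  have hΦac : AbsolutelyContinuousOnInterval (fun t => Φ (Z t)) a b :=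
    absolutelyContinuousOnInterval_of_dist_le hZ.ac fun x _ y _ => hlip.dist_le_mul _ _
  have hnac : AbsolutelyContinuousOnInterval (fun t => ‖Z t‖ ^ 2 / 2) a b := by
    have h₁ : AbsolutelyContinuousOnInterval (fun t => ‖Z t‖) a b :=
      absolutelyContinuousOnInterval_of_dist_le (K := 1) hZ.ac fun x _ y _ => by
        rw [one_mul, dist_eq_norm (Z x)]
        exact dist_norm_norm_le (Z x) (Z y)
    have h₂ := (h₁.fun_mul h₁).const_mul (1 / 2)
    convert h₂ using 2
    ring
  have hβac := absolutelyContinuousOnInterval_weight hβ ha hab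
  have hidac : AbsolutelyContinuousOnInterval (fun t : ℝ => t) a b :=
    (LipschitzWith.id.lipschitzOnWith).absolutelyContinuousOnInterval
  obtain ⟨i₁, e₁⟩ := integrable_and_integral_mul_inner_subgradient hab hZ hΦac
    (fun t => hg (Z t)) hβac
  obtain ⟨i₂, e₂⟩ := integrable_and_integral_mul_inner_subgradient hab hZ
    (Φ := fun x => ‖x‖ ^ 2 / 2) hnac
    (fun t => id_mem_subdifferential_half_norm_sq (Z t)) (hidac.fun_mul hβac)
  have i₃ : IntegrableOn (fun t => t ^ 2 * β t * ‖deriv Z t‖ ^ 2) (Icc a b) :=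
    integrableOn_mul_norm_sq ((hidc.pow 2).mul hβc) hZ.memLp
  have i₄ := integrableOn_slope ha hβ hR hs
  have c₁ : ContinuousOn (fun t => β t / 4 * ‖Z t‖ ^ 2 + β t / (2 * t) * m (Z t)) (Icc a b) :=
    ((hβc.div_const 4).mul (hZc.norm.pow 2)).add ((hβc.div (continuousOn_const.mul hidc)
      fun t ht => (mul_pos two_pos (hpos t ht)).ne').mul (hmc.comp_continuousOn hZc))
  have i₅ := c₁.integrableOn_Icc (μ := volume)
  have c₂ : ContinuousOn (fun t => deriv β t * Φ (Z t)) (Icc a b) :=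
    hβ'c.mul (hlip.continuous.comp_continuousOn hZc)
  have c₃ : ContinuousOn (fun t => (β t + t * deriv β t) * (‖Z t‖ ^ 2 / 2)) (Icc a b) :=
    (hβc.add (hidc.mul hβ'c)).mul ((hZc.norm.pow 2).div_const 2)
  have i₆ := c₂.integrableOn_Icc (μ := volume)
  have i₇ := c₃.integrableOn_Icc (μ := volume)
  have hexp : ∀ t ∈ Icc a b,
      t ^ 2 * β t * ‖deriv Z t‖ ^ 2 + β t / (4 * t ^ 2) * ‖g (Z t)‖ ^ 2
        + β t * inner ℝ (g (Z t)) (deriv Z t) + t * β t * inner ℝ (Z t) (deriv Z t)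
        + (β t / 4 * ‖Z t‖ ^ 2 + β t / (2 * t) * m (Z t))
      = ‖t • deriv Z t + (1 / 2 : ℝ) • Z t + (1 / (2 * t)) • g (Z t)‖ ^ 2 * β t := by
    intro t ht
    have ht₀ := (hpos t ht).ne'
    rw [← hm, ← real_inner_self_eq_norm_sq (t • deriv Z t + (1 / 2 : ℝ) • Z t + _)]
    simp only [inner_add_left, inner_add_right, real_inner_smul_left, real_inner_smul_right]
    simp only [real_inner_self_eq_norm_sq]
    rw [real_inner_comm (Z t) (deriv Z t), real_inner_comm (g (Z t)) (deriv Z t),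
      real_inner_comm (g (Z t)) (Z t)]
    field_simp
    ring
  have hderiv : ∀ t ∈ Icc a b, deriv (fun t => t * β t) t = β t + t * deriv β t := by
    intro t ht
    have : DifferentiableAt ℝ β t :=
      (hβ.differentiableOn (by simp)).differentiableAt (Ioi_mem_nhds (hpos t ht))
    simpa using ((hasDerivAt_id t).fun_mul this.hasDerivAt).deriv
  have e₃ : ∫ t in Icc a b, deriv (fun t => t * β t) t * (‖Z t‖ ^ 2 / 2)
      = ∫ t in Icc a b, (β t + t * deriv β t) * (‖Z t‖ ^ 2 / 2) :=
    setIntegral_congr_fun measurableSet_Icc fun t ht => by simp only [hderiv t ht]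
  have j₁ : IntegrableOn (fun t => t ^ 2 * β t * ‖deriv Z t‖ ^ 2
      + β t / (4 * t ^ 2) * ‖g (Z t)‖ ^ 2) (Icc a b) := i₃.add i₄
  have j₂ : IntegrableOn (fun t => t ^ 2 * β t * ‖deriv Z t‖ ^ 2
      + β t / (4 * t ^ 2) * ‖g (Z t)‖ ^ 2 + β t * inner ℝ (g (Z t)) (deriv Z t)) (Icc a b) :=
    j₁.add i₁
  have j₃ : IntegrableOn (fun t => t ^ 2 * β t * ‖deriv Z t‖ ^ 2
      + β t / (4 * t ^ 2) * ‖g (Z t)‖ ^ 2 + β t * inner ℝ (g (Z t)) (deriv Z t)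
      + t * β t * inner ℝ (Z t) (deriv Z t)) (Icc a b) := j₂.add i₂
  refine ⟨IntegrableOn.congr_fun (j₃.add i₅) hexp measurableSet_Icc, ?_⟩
  rw [← setIntegral_congr_fun measurableSet_Icc hexp, integral_add j₃ i₅, integral_add j₂ i₂,
    integral_add j₁ i₁, integral_add i₃ i₄, e₁, e₂, e₃, crossTerm]
  have e₄ : ∫ t in Icc a b, ((-(β t / 4) - t * deriv β t / 2) * ‖Z t‖ ^ 2
      + β t / (2 * t) * m (Z t) - deriv β t * Φ (Z t))
      = (∫ t in Icc a b, (β t / 4 * ‖Z t‖ ^ 2 + β t / (2 * t) * m (Z t)))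
        - (∫ t in Icc a b, (β t + t * deriv β t) * (‖Z t‖ ^ 2 / 2))
        - ∫ t in Icc a b, deriv β t * Φ (Z t) := by
    have j₄ : IntegrableOn (fun t => β t / 4 * ‖Z t‖ ^ 2 + β t / (2 * t) * m (Z t)
        - (β t + t * deriv β t) * (‖Z t‖ ^ 2 / 2)) (Icc a b) := i₅.sub i₇
    rw [← integral_sub i₅ i₇, ← integral_sub j₄ i₆]
    refine integral_congr_ae (Eventually.of_forall fun t => ?_)
    simp only
    ring
  rw [e₄]
  ring

/-- The cross term is continuous under pointwise, uniformly bounded convergence of the curves,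
when the potentials converge uniformly. -/
theorem tendsto_crossTerm (ha : 0 < a) (hab : a ≤ b) {β : ℝ → ℝ}
    (hβ : ContDiffOn ℝ ∞ β (Ioi 0)) {κ : Type*} {l : Filter κ} [l.IsCountablyGenerated]
    {Φ m : κ → H → ℝ} {f : H → ℝ} (hf : Continuous f) (hΦc : ∀ᶠ i in l, Continuous (Φ i))
    (hmc : ∀ᶠ i in l, Continuous (m i)) {δ : κ → ℝ} (hδ : Tendsto δ l (𝓝 0))
    (hΦ : ∀ᶠ i in l, ∀ z, |Φ i z - f z| ≤ δ i) (hm : ∀ᶠ i in l, ∀ z, |m i z - f z| ≤ δ i)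
    {Y : κ → ℝ → H} (hY : ∀ᶠ i in l, ContinuousOn (Y i) (Icc a b))
    {M : ℝ} (hM : ∀ᶠ i in l, ∀ t ∈ Icc a b, ‖Y i t‖ ≤ M)
    (hlim : ∀ t ∈ Icc a b, Tendsto (fun i => Y i t) l (𝓝 (Z t))) :
    Tendsto (fun i => crossTerm β (Φ i) (m i) (Y i) a b) l (𝓝 (crossTerm β f f Z a b)) := by
  have : ProperSpace H := FiniteDimensional.proper_real H
  obtain ⟨hβc, hβ'c⟩ := continuousOn_weight (b := b) hβ ha
  have hpos : ∀ t ∈ Icc a b, 0 < t := fun t ht => ha.trans_le ht.1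
  have hidc : ContinuousOn (fun t : ℝ => t) (Icc a b) := continuousOn_id
  have hval : ∀ Ψ : κ → H → ℝ, (∀ᶠ i in l, ∀ z, |Ψ i z - f z| ≤ δ i) → ∀ t ∈ Icc a b,
      Tendsto (fun i => Ψ i (Y i t)) l (𝓝 (f (Z t))) := by
    intro Ψ hΨ t ht
    have h₁ : Tendsto (fun i => Ψ i (Y i t) - f (Y i t)) l (𝓝 0) :=
      squeeze_zero_norm' (hΨ.mono fun i hi => hi _) hδ
    simpa using h₁.add ((hf.tendsto (Z t)).comp (hlim t ht))
  have hlb := left_mem_Icc.2 hab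
  have hrb := right_mem_Icc.2 hab
  obtain ⟨C, hC⟩ := (isCompact_closedBall (0 : H) M).exists_bound_of_continuousOn hf.continuousOn
  have hbd : ∀ Ψ : κ → H → ℝ, (∀ᶠ i in l, ∀ z, |Ψ i z - f z| ≤ δ i) →
      ∀ᶠ i in l, ∀ t ∈ Icc a b, |Ψ i (Y i t)| ≤ C + 1 := by
    intro Ψ hΨ
    filter_upwards [hΨ, hM, hδ.eventually (ge_mem_nhds zero_lt_one)] with i h₁ h₂ h₃ t ht
    have h₄ := hC (Y i t) (by simpa using h₂ t ht)
    rw [Real.norm_eq_abs] at h₄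
    have h₅ := abs_le.1 ((h₁ (Y i t)).trans h₃)
    have h₆ := abs_le.1 h₄
    exact abs_le.2 ⟨by linarith, by linarith⟩
  have c₁ : ContinuousOn (fun t => -(β t / 4) - t * deriv β t / 2) (Icc a b) :=
    (hβc.div_const 4).neg.sub ((hidc.mul hβ'c).div_const 2)
  have c₂ : ContinuousOn (fun t => β t / (2 * t)) (Icc a b) :=
    hβc.div (continuousOn_const.mul hidc) fun t ht => (mul_pos two_pos (hpos t ht)).ne'
  refine Tendsto.add (Tendsto.sub (Tendsto.add ?_ ?_) (Tendsto.add ?_ ?_)) ?_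
  · exact (((hlim b hrb).norm.pow 2).div_const 2).const_mul _
  · exact (hval Φ hΦ b hrb).const_mul _
  · exact (((hlim a hlb).norm.pow 2).div_const 2).const_mul _
  · exact (hval Φ hΦ a hlb).const_mul _
  refine tendsto_integral_filter_of_dominated_convergence
    (fun t => |-(β t / 4) - t * deriv β t / 2| * M ^ 2 + |β t / (2 * t)| * (C + 1)
      + |deriv β t| * (C + 1)) ?_ ?_ ?_ ?_
  · filter_upwards [hΦc, hmc, hY] with i h₁ h₂ h₃
    exact (((c₁.mul (h₃.norm.pow 2)).add (c₂.mul (h₂.comp_continuousOn h₃))).sub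
      (hβ'c.mul (h₁.comp_continuousOn h₃))).aestronglyMeasurable measurableSet_Icc
  · filter_upwards [hM, hbd Φ hΦ, hbd m hm] with i h₁ h₂ h₃
    filter_upwards [ae_restrict_mem measurableSet_Icc] with t ht
    rw [Real.norm_eq_abs]
    refine (abs_sub _ _).trans (add_le_add ((abs_add_le _ _).trans (add_le_add ?_ ?_)) ?_)
    · rw [abs_mul, abs_of_nonneg (sq_nonneg ‖Y i t‖)]
      exact mul_le_mul_of_nonneg_left (pow_le_pow_left₀ (norm_nonneg _) (h₁ t ht) 2)
        (abs_nonneg _)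
    · rw [abs_mul]
      exact mul_le_mul_of_nonneg_left (h₃ t ht) (abs_nonneg _)
    · rw [abs_mul]
      exact mul_le_mul_of_nonneg_left (h₂ t ht) (abs_nonneg _)
  · exact (((c₁.abs.mul continuousOn_const).add (c₂.abs.mul continuousOn_const)).add
      (hβ'c.abs.mul continuousOn_const)).integrableOn_Icc
  · filter_upwards [ae_restrict_mem measurableSet_Icc] with t ht
    exact ((((hlim t ht).norm.pow 2).const_mul _).add ((hval m hm t ht).const_mul _)).sub
      ((hval Φ hΦ t ht).const_mul _)

end Energy

/-! ### The lower bound -/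

section Rescaling

variable {t₀ t₁ : ℝ}

theorem norm_pos_le {E : Type*} [NormedAddCommGroup E] (h : t₀ ≤ t₁)
    (X : C(Icc t₀ t₁, E)) (t : ℝ) : ‖pos h X t‖ ≤ ‖X‖ :=
  ContinuousMap.norm_coe_le_norm X _

variable {H : Type*} [NormedAddCommGroup H] [InnerProductSpace ℝ H]

/-- The curve `t ↦ X_t / t`. The gradient of `f_ε(t, ·)` at `X` is a function of `X / t` alone. -/
def rescale (h : t₀ ≤ t₁) (X : C(Icc t₀ t₁, H)) (t : ℝ) : H := t⁻¹ • pos h X t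

theorem continuousOn_rescale (h₀ : 0 < t₀) (h : t₀ ≤ t₁) (X : C(Icc t₀ t₁, H)) :
    ContinuousOn (rescale h X) (Icc t₀ t₁) :=
  (continuousOn_inv₀.mono fun _ ht => (h₀.trans_le ht.1).ne').smul
    (X.continuous.Icc_extend' (h := h)).continuousOn

theorem norm_rescale_le (h₀ : 0 < t₀) (h : t₀ ≤ t₁) (X : C(Icc t₀ t₁, H)) {t : ℝ}
    (ht : t ∈ Icc t₀ t₁) : ‖rescale h X t‖ ≤ t₀⁻¹ * ‖X‖ := by
  have htpos := h₀.trans_le ht.1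
  rw [rescale, norm_smul, norm_inv, Real.norm_of_nonneg htpos.le]
  exact mul_le_mul (inv_anti₀ h₀ ht.1) (norm_pos_le h X t) (norm_nonneg _) (inv_pos.2 h₀).le

theorem tendsto_rescale {κ : Type*} {l : Filter κ} (h : t₀ ≤ t₁) {u : κ → C(Icc t₀ t₁, H)}
    {X : C(Icc t₀ t₁, H)} (hu : Tendsto u l (𝓝 X)) (t : ℝ) :
    Tendsto (fun i => rescale h (u i) t) l (𝓝 (rescale h X t)) := by
  refine Tendsto.const_smul ?_ _
  exact ((continuous_eval_const (projIcc t₀ t₁ h t)).tendsto X).comp hu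

variable [FiniteDimensional ℝ H]

theorem isSobolev_id_smul (h : t₀ ≤ t₁) {Z : ℝ → H} (hZ : IsSobolev Z t₀ t₁) :
    IsSobolev (fun t => t • Z t) t₀ t₁ :=
  hZ.smul_lipschitz h (K := 1) LipschitzWith.id.lipschitzOnWith

theorem isSobolev_inv_smul (h₀ : 0 < t₀) (h : t₀ ≤ t₁) {Z : ℝ → H} (hZ : IsSobolev Z t₀ t₁) :
    IsSobolev (fun t => t⁻¹ • Z t) t₀ t₁ := by
  have hc : ContDiffOn ℝ 1 (fun t : ℝ => t⁻¹) (Icc t₀ t₁) :=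
    contDiffOn_id.inv fun t ht => (h₀.trans_le ht.1).ne'
  obtain ⟨K, hK⟩ := hc.exists_lipschitzOnWith (by decide) (convex_Icc _ _) isCompact_Icc
  exact hZ.smul_lipschitz h hK

theorem isH1_iff_isSobolev_rescale (h₀ : 0 < t₀) (h : t₀ ≤ t₁) (X : C(Icc t₀ t₁, H)) :
    IsH1 h X ↔ IsSobolev (rescale h X) t₀ t₁ := by
  rw [isH1_iff_isSobolev]
  refine ⟨fun hX => isSobolev_inv_smul h₀ h hX, fun hZ => ?_⟩
  exact (isSobolev_id_smul h hZ).congr h fun t ht =>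
    (smul_inv_smul₀ (h₀.trans_le ht.1).ne' _).symm

theorem ae_velocity_eq (h₀ : 0 < t₀) (h : t₀ ≤ t₁) (X : C(Icc t₀ t₁, H))
    (hZ : IsSobolev (rescale h X) t₀ t₁) :
    ∀ᵐ t ∂volume.restrict (Icc t₀ t₁),
      velocity h X t = rescale h X t + t • deriv (rescale h X) t := by
  filter_upwards [ae_mem_Ioo t₀ t₁, hZ.ae_hasDerivAt h] with t ht hd
  have htpos : 0 < t := h₀.trans ht.1
  have h₁ : HasDerivAt (fun s => s • rescale h X s)
      (t • deriv (rescale h X) t + (1 : ℝ) • rescale h X t) t := (hasDerivAt_id t).fun_smul hd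
  rw [one_smul, add_comm] at h₁
  refine (h₁.congr_of_eventuallyEq ?_).deriv
  filter_upwards [Ioi_mem_nhds htpos] with s hs
  exact (smul_inv_smul₀ (ne_of_gt hs) _).symm

end Rescaling

section Action

variable {H : Type*} [NormedAddCommGroup H] [InnerProductSpace ℝ H]

/-- The action of `X` as a function of `Z = X / t`, in expanded form: `g` is a field of
subgradients of `Φ`. -/
def energy (β : ℝ → ℝ) (Φ : H → ℝ) (g : H → H) (Z : ℝ → H) (a b : ℝ) : ℝ :=
  (∫ t in Icc a b, t ^ 2 * β t * ‖deriv Z t‖ ^ 2)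
    + (∫ t in Icc a b, β t / (4 * t ^ 2) * ‖g (Z t)‖ ^ 2)
    + crossTerm β Φ (fun z => inner ℝ (g z) z) Z a b

variable {d N : ℕ}

/-- The action in the variable `X / t`, for a drift `G t X = g (X / t)` given by bounded
subgradients `g`. -/
theorem action_eq_energy {P Q : Config d N} {t₀ t₁ : ℝ} (h₀ : 0 < t₀) (h : t₀ ≤ t₁) {β : ℝ → ℝ}
    (hβ : ContDiffOn ℝ ∞ β (Ioi 0)) (hβpos : ∀ t > 0, 0 < β t)
    {G : ℝ → Config d N → Config d N} {Φ : Config d N → ℝ} {g : Config d N → Config d N}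
    {R : NNReal} (hG : ∀ t > 0, ∀ Y, G t Y = g (t⁻¹ • Y))
    (hg : ∀ z, g z ∈ subdifferential Φ z) (hR : ∀ z, ‖g z‖ ≤ R)
    (hm : Continuous fun z => inner ℝ (g z) z) {X : C(Icc t₀ t₁, Config d N)}
    (hs : AEStronglyMeasurable (fun t => ‖g (rescale h X t)‖) (volume.restrict (Icc t₀ t₁)))
    (hX : IsH1 h X) (hP : ∃ σ, pos h X t₀ = permute P σ) (hQ : ∃ σ, pos h X t₁ = permute Q σ) :
    action P Q h β G X = ENNReal.ofReal (energy β Φ g (rescale h X) t₀ t₁) := by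
  have hZ := (isH1_iff_isSobolev_rescale h₀ h X).1 hX
  obtain ⟨hi, he⟩ := integrable_and_action_expansion h₀ h hZ hβ hg hR (fun z => rfl) hm hs
  rw [action, if_pos ⟨hX, hP, hQ⟩, energy, ← he, ofReal_integral_eq_lintegral_ofReal hi]
  · refine lintegral_congr_ae ?_
    filter_upwards [ae_velocity_eq h₀ h X hZ, ae_restrict_mem measurableSet_Icc] with t hv ht
    have htpos : 0 < t := h₀.trans_le ht.1
    have hpos : pos h X t = t • rescale h X t := (smul_inv_smul₀ htpos.ne' _).symm
    rw [hv, hG t htpos]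
    congr 4
    change _ - (1 / (2 * t)) • (pos h X t - g (rescale h X t)) = _
    rw [hpos, smul_sub, smul_smul]
    have : 1 / (2 * t) * t = 1 / 2 := by field_simp
    rw [this]
    module
  · filter_upwards [ae_restrict_mem measurableSet_Icc] with t ht
    exact mul_nonneg (sq_nonneg _) (hβpos t (h₀.trans_le ht.1)).le

theorem norm_permute (A : Config d N) (σ : Equiv.Perm (Fin N)) : ‖permute A σ‖ = ‖A‖ := by
  rw [PiLp.norm_eq_of_L2, PiLp.norm_eq_of_L2]
  congr 1
  exact Equiv.sum_comp σ fun i => ‖A i‖ ^ 2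

theorem fEps_eq_softMax (A : Config d N) (ε t : ℝ) (X : Config d N) :
    fEps A ε t X = softMax (permute A) (ε * t) X := by
  rw [fEps, softMax, Fintype.card_perm, Fintype.card_fin, mul_comm t ε]

/-- The temperature scales with the point: this is what makes `X / t` the natural variable. -/
theorem gibbsMean_mul {ι : Type*} [Fintype ι] (a : ι → H) (ε t : ℝ) (X : H) :
    gibbsMean a (ε * t) X = gibbsMean a ε (t⁻¹ • X) := by
  have : ∀ i, inner ℝ X (a i) / (ε * t) = inner ℝ (t⁻¹ • X) (a i) / ε := fun i => by
    rw [real_inner_smul_left, mul_comm ε t, ← div_div,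
      div_eq_inv_mul (inner ℝ X (a i)) t]
  simp only [gibbsMean, gibbsWeight, this]

theorem gradient_fEps (A : Config d N) {ε t : ℝ} (hε : 0 < ε) (ht : 0 < t) (X : Config d N) :
    gradient (fEps A ε t) X = gibbsMean (permute A) ε (t⁻¹ • X) := by
  rw [show fEps A ε t = softMax (permute A) (ε * t) from funext (fEps_eq_softMax A ε t),
    (hasGradientAt_of_continuous_subgradient
      (fun z => gibbsMean_mem_subdifferential (permute A) (ε * t) z (mul_pos hε ht))
      (continuous_gibbsMean (permute A) (ε * t)) X).gradient, gibbsMean_mul]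

theorem norm_gibbsMean_permute_le (A : Config d N) (ε : ℝ) (z : Config d N) :
    ‖gibbsMean (permute A) ε z‖ ≤ ‖A‖₊ :=
  norm_gibbsMean_le _ _ _ fun σ => (norm_permute A σ).le

theorem continuous_inner_gibbsMean {ι : Type*} [Fintype ι] [Nonempty ι] (a : ι → H) (ε : ℝ) :
    Continuous fun z => inner ℝ (gibbsMean a ε z) z :=
  (continuous_gibbsMean a ε).inner continuous_id

theorem actionEps_eq_energy (A P Q : Config d N) {t₀ t₁ : ℝ} (h₀ : 0 < t₀) (h : t₀ ≤ t₁)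
    {β : ℝ → ℝ} (hβ : ContDiffOn ℝ ∞ β (Ioi 0)) (hβpos : ∀ t > 0, 0 < β t) {ε : ℝ} (hε : 0 < ε)
    {X : C(Icc t₀ t₁, Config d N)} (hX : IsH1 h X) (hP : ∃ σ, pos h X t₀ = permute P σ)
    (hQ : ∃ σ, pos h X t₁ = permute Q σ) :
    actionEps A P Q h β ε X = ENNReal.ofReal
      (energy β (softMax (permute A) ε) (gibbsMean (permute A) ε) (rescale h X) t₀ t₁) :=
  action_eq_energy h₀ h hβ hβpos (fun _ ht Y => gradient_fEps A hε ht Y)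
    (fun z => gibbsMean_mem_subdifferential _ _ z hε) (norm_gibbsMean_permute_le A ε)
    (continuous_inner_gibbsMean _ ε)
    (((continuous_gibbsMean _ ε).norm.comp_continuousOn
      (continuousOn_rescale h₀ h X)).aestronglyMeasurable measurableSet_Icc) hX hP hQ

theorem inner_extendedGradient_maxInner {ι : Type*} [Fintype ι] [Nonempty ι] [CompleteSpace H]
    (a : ι → H) (z : H) : inner ℝ (extendedGradient (maxInner a) z) z = maxInner a z :=
  inner_eq_maxInner_of_mem_subdifferential a z
    (extendedGradient_spec (subdifferential_maxInner_nonempty a z)).1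

/-- Only the norm of the minimal subgradient enters the slope part; it is measurable along a curve
because it is lower semicontinuous in space. -/
theorem aestronglyMeasurable_norm_extendedGradient {ι : Type*} [Fintype ι] [Nonempty ι]
    [FiniteDimensional ℝ H] (a : ι → H) {Z : ℝ → H} {t₀ t₁ : ℝ}
    (hZ : ContinuousOn Z (Icc t₀ t₁)) :
    AEStronglyMeasurable (fun t => ‖extendedGradient (maxInner a) (Z t)‖)
      (volume.restrict (Icc t₀ t₁)) := by
  borelize H
  exact ((lowerSemicontinuous_norm_extendedGradient a).measurable.comp_aemeasurable
    (hZ.aemeasurable measurableSet_Icc)).aestronglyMeasurable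

theorem norm_extendedGradient_permute_le (A z : Config d N) :
    ‖extendedGradient (maxInner (permute A)) z‖ ≤ ‖A‖₊ :=
  norm_extendedGradient_maxInner_le _ _ fun σ => (norm_permute A σ).le

theorem actionLim_eq_energy (A P Q : Config d N) {t₀ t₁ : ℝ} (h₀ : 0 < t₀) (h : t₀ ≤ t₁)
    {β : ℝ → ℝ} (hβ : ContDiffOn ℝ ∞ β (Ioi 0)) (hβpos : ∀ t > 0, 0 < β t)
    {X : C(Icc t₀ t₁, Config d N)} (hX : IsH1 h X) (hP : ∃ σ, pos h X t₀ = permute P σ)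
    (hQ : ∃ σ, pos h X t₁ = permute Q σ) :
    actionLim A P Q h β X = ENNReal.ofReal (energy β (maxInner (permute A))
      (extendedGradient (maxInner (permute A))) (rescale h X) t₀ t₁) := by
  refine action_eq_energy h₀ h hβ hβpos
    (fun t ht Y => (extendedGradient_maxInner_smul (permute A) Y (inv_pos.2 ht)).symm)
    (fun z => (extendedGradient_spec (subdifferential_maxInner_nonempty _ z)).1)
    (norm_extendedGradient_permute_le A) ?_
    (aestronglyMeasurable_norm_extendedGradient _ (continuousOn_rescale h₀ h X)) hX hP hQ
  simp only [inner_extendedGradient_maxInner]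
  exact continuous_maxInner _

theorem action_ne_top {P Q : Config d N} {t₀ t₁ : ℝ} {h : t₀ ≤ t₁} {β : ℝ → ℝ}
    {G : ℝ → Config d N → Config d N} {X : C(Icc t₀ t₁, Config d N)}
    (hX : action P Q h β G X ≠ ⊤) :
    IsH1 h X ∧ (∃ σ, pos h X t₀ = permute P σ) ∧ (∃ σ, pos h X t₁ = permute Q σ) := by
  by_contra hcon
  exact hX (if_neg hcon)

end Action

section LowerBound

variable {d N : ℕ}

/-- Uniform limits of curves with prescribed endpoints, up to permutation, have such endpoints. -/
theorem exists_pos_eq_permute_of_tendsto {P : Config d N} {t₀ t₁ : ℝ} (h : t₀ ≤ t₁) {κ : Type*}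
    {l : Filter κ} [l.NeBot] {u : κ → C(Icc t₀ t₁, Config d N)} {X : C(Icc t₀ t₁, Config d N)}
    (hu : Tendsto u l (𝓝 X)) {t : ℝ} (hP : ∀ i, ∃ σ, pos h (u i) t = permute P σ) :
    ∃ σ, pos h X t = permute P σ := by
  have h₁ : Tendsto (fun i => pos h (u i) t) l (𝓝 (pos h X t)) :=
    ((continuous_eval_const (projIcc t₀ t₁ h t)).tendsto X).comp hu
  have h₂ := (finite_range (permute P)).isClosed.mem_of_tendsto h₁
    (Eventually.of_forall fun i => (hP i).imp fun _ => Eq.symm)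
  exact h₂.imp fun _ => Eq.symm

/-- Along bounded converging curves, the cross terms of the approximate energies converge. -/
theorem tendsto_crossTerm_softMax {H : Type*} [NormedAddCommGroup H] [InnerProductSpace ℝ H]
    [FiniteDimensional ℝ H] {ι : Type*} [Fintype ι] [Nonempty ι] (a : ι → H) {t₀ t₁ : ℝ}
    (h₀ : 0 < t₀) (h : t₀ ≤ t₁) {β : ℝ → ℝ} (hβ : ContDiffOn ℝ ∞ β (Ioi 0)) {κ : Type*}
    {l : Filter κ} [l.IsCountablyGenerated] {ε : κ → ℝ} (hε : Tendsto ε l (𝓝[>] 0))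
    {Y : κ → ℝ → H} {Z : ℝ → H} (hY : ∀ᶠ i in l, ContinuousOn (Y i) (Icc t₀ t₁)) {M : ℝ}
    (hM : ∀ᶠ i in l, ∀ t ∈ Icc t₀ t₁, ‖Y i t‖ ≤ M)
    (hlim : ∀ t ∈ Icc t₀ t₁, Tendsto (fun i => Y i t) l (𝓝 (Z t))) :
    Tendsto (fun i => crossTerm β (softMax a (ε i)) (fun z => inner ℝ (gibbsMean a (ε i) z) z)
      (Y i) t₀ t₁) l (𝓝 (crossTerm β (maxInner a)
        (fun z => inner ℝ (extendedGradient (maxInner a) z) z) Z t₀ t₁)) := by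
  have : CompleteSpace H := FiniteDimensional.complete ℝ H
  simp only [inner_extendedGradient_maxInner]
  have hpos : ∀ᶠ i in l, 0 < ε i := hε.eventually self_mem_nhdsWithin
  have hδ : Tendsto (fun i => ε i * Real.log (Fintype.card ι)) l (𝓝 0) := by
    simpa using (hε.mono_right nhdsWithin_le_nhds).mul_const (Real.log (Fintype.card ι))
  refine tendsto_crossTerm h₀ h hβ (continuous_maxInner a) (hpos.mono fun i hi => ?_)
    (Eventually.of_forall fun i => continuous_inner_gibbsMean a (ε i)) hδ
    (hpos.mono fun i hi z => abs_softMax_sub_maxInner_le a (ε i) z hi)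
    (hpos.mono fun i hi z => abs_inner_gibbsMean_sub_le a (ε i) z hi) hY hM hlim
  exact continuous_iff_continuousAt.2 fun z => (hasGradientAt_of_continuous_subgradient
    (fun z => gibbsMean_mem_subdifferential a (ε i) z hi)
    (continuous_gibbsMean a (ε i)) z).continuousAt

/-- Fatou's lemma for the slope part of the energy. -/
theorem ofReal_slope_le_liminf {H : Type*} [NormedAddCommGroup H] [InnerProductSpace ℝ H]
    [FiniteDimensional ℝ H] {ι : Type*} [Fintype ι] [Nonempty ι] (a : ι → H) {R : ℝ}
    (hR : ∀ i, ‖a i‖ ≤ R) {t₀ t₁ : ℝ}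
    (h₀ : 0 < t₀) {β : ℝ → ℝ} (hβ : ContDiffOn ℝ ∞ β (Ioi 0))
    (hβpos : ∀ t > 0, 0 < β t) {κ : Type*} {l : Filter κ} [l.IsCountablyGenerated] {ε : κ → ℝ}
    (hε : Tendsto ε l (𝓝[>] 0)) {Y : κ → ℝ → H} {Z : ℝ → H}
    (hY : ∀ i, ContinuousOn (Y i) (Icc t₀ t₁)) (hZ : ContinuousOn Z (Icc t₀ t₁))
    (hlim : ∀ t ∈ Icc t₀ t₁, Tendsto (fun i => Y i t) l (𝓝 (Z t))) :
    ENNReal.ofReal (∫ t in Icc t₀ t₁,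
        β t / (4 * t ^ 2) * ‖extendedGradient (maxInner a) (Z t)‖ ^ 2)
      ≤ liminf (fun i => ENNReal.ofReal (∫ t in Icc t₀ t₁,
        β t / (4 * t ^ 2) * ‖gibbsMean a (ε i) (Y i t)‖ ^ 2)) l := by
  have : CompleteSpace H := FiniteDimensional.complete ℝ H
  have hw : ∀ t ∈ Icc t₀ t₁, 0 ≤ β t / (4 * t ^ 2) := fun t ht =>
    div_nonneg (hβpos t (h₀.trans_le ht.1)).le (by positivity)
  have hnn : ∀ g : ℝ → H, 0 ≤ᵐ[volume.restrict (Icc t₀ t₁)]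
      fun t => β t / (4 * t ^ 2) * ‖g t‖ ^ 2 := fun g => by
    filter_upwards [ae_restrict_mem measurableSet_Icc] with t ht
    exact mul_nonneg (hw t ht) (sq_nonneg _)
  have hi : ∀ i, IntegrableOn (fun t => β t / (4 * t ^ 2) * ‖gibbsMean a (ε i) (Y i t)‖ ^ 2)
      (Icc t₀ t₁) := fun i => integrableOn_slope h₀ hβ (fun z => norm_gibbsMean_le a (ε i) z hR)
    (((continuous_gibbsMean a (ε i)).norm.comp_continuousOn (hY i)).aestronglyMeasurable
      measurableSet_Icc)
  rw [ofReal_integral_eq_lintegral_ofReal (integrableOn_slope h₀ hβ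
    (fun z => norm_extendedGradient_maxInner_le a z hR)
    (aestronglyMeasurable_norm_extendedGradient a hZ)) (hnn _)]
  simp only [fun i => ofReal_integral_eq_lintegral_ofReal (hi i) (hnn _)]
  refine le_trans (lintegral_mono_ae ?_)
    (lintegral_liminf_le' fun i => (hi i).aestronglyMeasurable.aemeasurable.ennreal_ofReal)
  filter_upwards [ae_restrict_mem measurableSet_Icc] with t ht
  exact ofReal_norm_sq_extendedGradient_le_liminf a hε (hlim t ht) (hw t ht)

theorem actionLim_le_liminf (A P Q : Config d N) {t₀ t₁ : ℝ} (h₀ : 0 < t₀) (h : t₀ ≤ t₁)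
    {β : ℝ → ℝ} (hβ : ContDiffOn ℝ ∞ β (Ioi 0)) (hβpos : ∀ t > 0, 0 < β t)
    (X : C(Icc t₀ t₁, Config d N)) (u : ℝ → C(Icc t₀ t₁, Config d N))
    (hu : Tendsto u (𝓝[>] 0) (𝓝 X)) :
    actionLim A P Q h β X ≤ liminf (fun ε => actionEps A P Q h β ε (u ε)) (𝓝[>] 0) := by
  by_contra! hcon
  obtain ⟨c, hc₁, hc₂⟩ := exists_between hcon
  have hctop : c ≠ ⊤ := (hc₂.trans_le le_top).ne
  have hfreq : ∃ᶠ ε in 𝓝[>] (0 : ℝ), actionEps A P Q h β ε (u ε) < c ∧ 0 < ε :=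
    (frequently_lt_of_liminf_lt (h := hc₁)).and_eventually self_mem_nhdsWithin
  obtain ⟨ε, hε, hlt⟩ := exists_seq_forall_of_frequently hfreq
  have huε : Tendsto (fun n => u (ε n)) atTop (𝓝 X) := hu.comp hε
  have hfin : ∀ n, IsH1 h (u (ε n)) ∧ (∃ σ, pos h (u (ε n)) t₀ = permute P σ) ∧
      (∃ σ, pos h (u (ε n)) t₁ = permute Q σ) := fun n =>
    action_ne_top ((hlt n).1.trans_le le_top).ne
  have hPX := exists_pos_eq_permute_of_tendsto h huε fun n => (hfin n).2.1
  have hQX := exists_pos_eq_permute_of_tendsto h huε fun n => (hfin n).2.2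
  have hE : ∀ n, energy β (softMax (permute A) (ε n)) (gibbsMean (permute A) (ε n))
      (rescale h (u (ε n))) t₀ t₁ ≤ c.toReal := by
    intro n
    have h₁ := (hlt n).1.le
    rwa [actionEps_eq_energy A P Q h₀ h hβ hβpos (hlt n).2 (hfin n).1 (hfin n).2.1 (hfin n).2.2,
      ENNReal.ofReal_le_iff_le_toReal hctop] at h₁
  have hlim : ∀ t ∈ Icc t₀ t₁, Tendsto (fun n => rescale h (u (ε n)) t) atTop
      (𝓝 (rescale h X t)) := fun t _ => tendsto_rescale h huε t
  have hbd : ∀ᶠ n in atTop, ∀ t ∈ Icc t₀ t₁,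
      ‖rescale h (u (ε n)) t‖ ≤ t₀⁻¹ * (‖X‖ + 1) := by
    filter_upwards [huε.norm.eventually (ge_mem_nhds (lt_add_one ‖X‖))] with n hn t ht
    exact (norm_rescale_le h₀ h _ ht).trans
      (mul_le_mul_of_nonneg_left hn (inv_pos.2 h₀).le)
  have hC := tendsto_crossTerm_softMax (permute A) h₀ h hβ hε
    (Eventually.of_forall fun n => continuousOn_rescale h₀ h (u (ε n))) hbd hlim
  have hS := ofReal_slope_le_liminf (permute A) (fun σ => (norm_permute A σ).le) h₀ hβ hβpos hε
    (fun n => continuousOn_rescale h₀ h (u (ε n))) (continuousOn_rescale h₀ h X) hlim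
  set C := crossTerm β (maxInner (permute A))
    (fun z => inner ℝ (extendedGradient (maxInner (permute A)) z) z) (rescale h X) t₀ t₁ with hCdef
  set S := ∫ t in Icc t₀ t₁, β t / (4 * t ^ 2) *
    ‖extendedGradient (maxInner (permute A)) (rescale h X t)‖ ^ 2 with hSdef
  -- The energies are at most `c`, and the two other parts are asymptotically at least `S` and `C`:
  -- this bounds the kinetic parts from above, up to an arbitrarily small error.
  have hkin : ∀ δ > 0, IsSobolev (rescale h X) t₀ t₁ ∧
      ∫ t in Icc t₀ t₁, t ^ 2 * β t * ‖deriv (rescale h X) t‖ ^ 2 ≤ c.toReal - S - C + 2 * δ := by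
    intro δ hδ
    refine isSobolev_and_kinetic_le_of_tendsto h (ρ := fun t => t ^ 2 * β t)
      ((continuousOn_id.pow 2).mul (continuousOn_weight hβ h₀).1)
      (fun t ht => mul_pos (pow_pos (h₀.trans_le ht.1) 2) (hβpos t (h₀.trans_le ht.1)))
      (fun n => (isH1_iff_isSobolev_rescale h₀ h _).1 (hfin n).1) ?_ hlim
    have hSδ : ∀ᶠ n in atTop, S - δ ≤ ∫ t in Icc t₀ t₁, β t / (4 * t ^ 2) *
        ‖gibbsMean (permute A) (ε n) (rescale h (u (ε n)) t)‖ ^ 2 := by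
      have hnn : ∀ n, 0 ≤ ∫ t in Icc t₀ t₁, β t / (4 * t ^ 2) *
          ‖gibbsMean (permute A) (ε n) (rescale h (u (ε n)) t)‖ ^ 2 := fun n =>
        setIntegral_nonneg measurableSet_Icc fun t ht => mul_nonneg
          (div_nonneg (hβpos t (h₀.trans_le ht.1)).le (by positivity)) (sq_nonneg _)
      rcases le_or_gt S 0 with hS₀ | hS₀
      · exact Eventually.of_forall fun n => le_trans (by linarith) (hnn n)
      · have h₁ : ENNReal.ofReal (S - δ) < ENNReal.ofReal S :=
          (ENNReal.ofReal_lt_ofReal_iff hS₀).2 (by linarith)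
        filter_upwards [eventually_lt_of_lt_liminf (h₁.trans_le hS)] with n hn
        exact (ENNReal.ofReal_le_ofReal_iff (hnn n)).1 hn.le
    filter_upwards [hSδ, hC.eventually (le_mem_nhds (sub_lt_self C hδ))] with n h₁ h₂
    have h₃ := hE n
    rw [energy] at h₃
    linarith
  have hX : IsH1 h X := (isH1_iff_isSobolev_rescale h₀ h X).2 (hkin 1 one_pos).1
  refine not_le.2 hc₂ ?_
  rw [actionLim_eq_energy A P Q h₀ h hβ hβpos hX hPX hQX,
    ENNReal.ofReal_le_iff_le_toReal hctop, energy, ← hCdef, ← hSdef]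
  refine le_of_forall_pos_le_add fun δ hδ => ?_
  linarith [(hkin (δ / 2) (half_pos hδ)).2]

end LowerBound

/-! ### Recovery curves -/

section Recovery

variable {H : Type*} [NormedAddCommGroup H] [InnerProductSpace ℝ H] {t₀ t₁ s : ℝ}

/-- The piecewise affine function equal to `1` at distance `0` and vanishing beyond `s`. -/
def hat (s x : ℝ) : ℝ := max (1 - x / s) 0

theorem hat_zero (s : ℝ) : hat s 0 = 1 := by simp [hat]

theorem hat_of_le (hs : 0 < s) {x : ℝ} (hx : s ≤ x) : hat s x = 0 :=
  max_eq_right (sub_nonpos.2 ((one_le_div hs).2 hx))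

theorem abs_hat_le (hs : 0 < s) {x : ℝ} (hx : 0 ≤ x) : |hat s x| ≤ 1 := by
  rw [hat, abs_of_nonneg (le_max_right _ _)]
  exact max_le (sub_le_self _ (div_nonneg hx hs.le)) zero_le_one

theorem abs_hat_sub_hat_le (hs : 0 < s) (x y : ℝ) : |hat s x - hat s y| ≤ |x - y| / s := by
  refine (abs_max_sub_max_le_abs _ _ _).trans_eq ?_
  rw [show 1 - x / s - (1 - y / s) = -((x - y) / s) by ring, abs_neg, abs_div, abs_of_pos hs]

/-- The affine boundary layers, of width `s` at both ends, which restore the endpoints. -/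
def layer (t₀ t₁ s : ℝ) (c₀ c₁ : H) (t : ℝ) : H := hat s (t - t₀) • c₀ + hat s (t₁ - t) • c₁

theorem norm_layer_le (hs : 0 < s) {c₀ c₁ : H} {B : ℝ} (h₀ : ‖c₀‖ ≤ B) (h₁ : ‖c₁‖ ≤ B) {t : ℝ}
    (ht : t ∈ Icc t₀ t₁) : ‖layer t₀ t₁ s c₀ c₁ t‖ ≤ 2 * B := by
  refine (norm_add_le _ _).trans ?_
  rw [norm_smul, norm_smul, two_mul]
  have hx := abs_hat_le hs (sub_nonneg.2 ht.1)
  have hy := abs_hat_le hs (sub_nonneg.2 ht.2)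
  exact add_le_add ((mul_le_of_le_one_left (norm_nonneg _) hx).trans h₀)
    ((mul_le_of_le_one_left (norm_nonneg _) hy).trans h₁)

theorem norm_layer_sub_le (hs : 0 < s) {c₀ c₁ : H} {B : ℝ} (h₀ : ‖c₀‖ ≤ B) (h₁ : ‖c₁‖ ≤ B)
    (x y : ℝ) :
    ‖layer t₀ t₁ s c₀ c₁ x - layer t₀ t₁ s c₀ c₁ y‖ ≤ 2 * (B / s) * ‖x - y‖ := by
  have hB : 0 ≤ B := (norm_nonneg _).trans h₀
  have e : layer t₀ t₁ s c₀ c₁ x - layer t₀ t₁ s c₀ c₁ y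
      = (hat s (x - t₀) - hat s (y - t₀)) • c₀ + (hat s (t₁ - x) - hat s (t₁ - y)) • c₁ := by
    simp only [layer]
    module
  have hx := abs_hat_sub_hat_le hs (x - t₀) (y - t₀)
  have hy := abs_hat_sub_hat_le hs (t₁ - x) (t₁ - y)
  rw [sub_sub_sub_cancel_right] at hx
  rw [sub_sub_sub_cancel_left, abs_sub_comm y x] at hy
  rw [e]
  calc _ ≤ |x - y| / s * B + |x - y| / s * B := by
        refine (norm_add_le _ _).trans ?_
        rw [norm_smul, norm_smul]
        exact add_le_add (mul_le_mul hx h₀ (norm_nonneg _) (by positivity))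
          (mul_le_mul hy h₁ (norm_nonneg _) (by positivity))
    _ = 2 * (B / s) * ‖x - y‖ := by
        rw [Real.norm_eq_abs]
        ring

/-- The kinetic part of the energy under an increase of the speed by at most `r`. -/
theorem kinetic_le_of_norm_deriv_le {ρ : ℝ → ℝ} (hρ : ContinuousOn ρ (Icc t₀ t₁))
    (hρpos : ∀ t ∈ Icc t₀ t₁, 0 ≤ ρ t) {Y Z : ℝ → H} (hY : IsSobolev Y t₀ t₁)
    (hZ : IsSobolev Z t₀ t₁) {r : ℝ}
    (hd : ∀ᵐ t ∂volume.restrict (Icc t₀ t₁), ‖deriv Y t‖ ≤ ‖deriv Z t‖ + r) :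
    ∫ t in Icc t₀ t₁, ρ t * ‖deriv Y t‖ ^ 2 ≤ (∫ t in Icc t₀ t₁, ρ t * ‖deriv Z t‖ ^ 2)
      + 2 * r * (∫ t in Icc t₀ t₁, ρ t * ‖deriv Z t‖) + r ^ 2 * ∫ t in Icc t₀ t₁, ρ t := by
  have i₁ := integrableOn_mul_norm_sq hρ hZ.memLp
  have i₂ : IntegrableOn (fun t => ρ t * ‖deriv Z t‖) (Icc t₀ t₁) :=
    IntegrableOn.continuousOn_mul (g := ρ) hρ (IsSobolev.integrable_deriv hZ).norm isCompact_Icc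
  have i₃ : IntegrableOn ρ (Icc t₀ t₁) := hρ.integrableOn_Icc
  have i₄ : IntegrableOn (fun t => ρ t * ‖deriv Z t‖ ^ 2 + 2 * r * (ρ t * ‖deriv Z t‖))
      (Icc t₀ t₁) := i₁.add (i₂.const_mul _)
  rw [← integral_const_mul, ← integral_const_mul, ← integral_add i₁ (i₂.const_mul _),
    ← integral_add i₄ (i₃.const_mul _)]
  refine integral_mono_ae (integrableOn_mul_norm_sq hρ hY.memLp) (i₄.add (i₃.const_mul _)) ?_
  filter_upwards [hd, ae_restrict_mem measurableSet_Icc] with t ht hmem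
  have h₁ := mul_le_mul_of_nonneg_left (pow_le_pow_left₀ (norm_nonneg _) ht 2) (hρpos t hmem)
  refine h₁.trans_eq ?_
  ring

variable [FiniteDimensional ℝ H]

theorem isSobolev_layer (h : t₀ ≤ t₁) (hs : 0 < s) (c₀ c₁ : H) :
    IsSobolev (layer t₀ t₁ s c₀ c₁) t₀ t₁ := by
  have hlip : ∀ v : ℝ → ℝ, (∀ x y, |v x - v y| = |x - y|) →
      LipschitzOnWith ⟨s⁻¹, (inv_pos.2 hs).le⟩ (fun t => hat s (v t)) (Icc t₀ t₁) := by
    intro v hv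
    refine LipschitzOnWith.of_dist_le_mul fun x _ y _ => ?_
    rw [Real.dist_eq, Real.dist_eq, ← hv x y]
    exact (abs_hat_sub_hat_le hs _ _).trans_eq (div_eq_inv_mul _ _)
  refine IsSobolev.add ((IsSobolev.const c₀ t₀ t₁).smul_lipschitz h (hlip (fun t => t - t₀) ?_)) h
    ((IsSobolev.const c₁ t₀ t₁).smul_lipschitz h (hlip (fun t => t₁ - t) ?_))
  · intro x y
    rw [sub_sub_sub_cancel_right]
  · intro x y
    rw [sub_sub_sub_cancel_left, abs_sub_comm]

/-- Construction of the recovery curve at temperature `s ^ 4`: in the variable `X / t`, apply the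
resolvent of the soft maximum with parameter `s ^ 2`, and restore the endpoints by affine boundary
layers of width `s`. The resolvent moves points by at most `s ^ 2 * R`, so that the layers change
the velocity by `O(s)` only. -/
theorem exists_recovery_curve {ι : Type*} [Fintype ι] [Nonempty ι] (a : ι → H) {R : ℝ}
    (hR : ∀ i, ‖a i‖ ≤ R) (h₀ : 0 < t₀) (h : t₀ ≤ t₁) {X : C(Icc t₀ t₁, H)} (hX : IsH1 h X)
    (hs : 0 < s) (hst : s ≤ t₁ - t₀) :
    ∃ u : C(Icc t₀ t₁, H), IsH1 h u ∧ pos h u t₀ = pos h X t₀ ∧ pos h u t₁ = pos h X t₁ ∧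
      dist u X ≤ t₁ * (3 * (s ^ 2 * R)) ∧
      (∀ᵐ t ∂volume.restrict (Icc t₀ t₁),
        ‖deriv (rescale h u) t‖ ≤ ‖deriv (rescale h X) t‖ + 2 * (s * R)) ∧
      ∀ t ∈ Icc t₀ t₁, ‖gibbsMean a (s ^ 4) (rescale h u t)‖ ^ 2
        ≤ ‖extendedGradient (maxInner a) (rescale h X t)‖ ^ 2
          + 2 * (s ^ 2 * Real.log (Fintype.card ι))
          + (Icc t₀ (t₀ + s) ∪ Icc (t₁ - s) t₁).indicator (fun _ => R ^ 2) t := by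
  have : CompleteSpace H := FiniteDimensional.complete ℝ H
  have hR₀ : 0 ≤ R := (norm_nonneg _).trans (hR (Classical.arbitrary ι))
  have hε : 0 < s ^ 4 := pow_pos hs 4
  have hτ : 0 < s ^ 2 := pow_pos hs 2
  have hsub := fun z => gibbsMean_mem_subdifferential a (s ^ 4) z hε
  have hgR := fun z => norm_gibbsMean_le a (s ^ 4) z hR
  choose J hJ using exists_resolvent hsub (continuous_gibbsMean a (s ^ 4)) hgR hτ
  have hZ := (isH1_iff_isSobolev_rescale h₀ h X).1 hX
  set Z := rescale h X with hZdef
  obtain ⟨hW, hWd⟩ := hZ.of_norm_sub_le (W := fun t => J (Z t)) h fun x _ y _ => by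
    have := norm_resolvent_sub_le hsub hτ.le (J (Z x)) (J (Z y))
    rwa [hJ, hJ] at this
  have hmove : ∀ z, ‖z - J z‖ ≤ s ^ 2 * R := fun z => by
    have e : z - J z = s ^ 2 • gibbsMean a (s ^ 4) (J z) := by
      rw [sub_eq_iff_eq_add', hJ]
    rw [e, norm_smul, Real.norm_of_nonneg hτ.le]
    exact mul_le_mul_of_nonneg_left (hgR _) hτ.le
  set E := layer t₀ t₁ s (Z t₀ - J (Z t₀)) (Z t₁ - J (Z t₁)) with hE
  have hES : IsSobolev E t₀ t₁ := isSobolev_layer h hs _ _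
  have hY := hW.add h hES
  have hYc : ContinuousOn (fun t => t • (J (Z t) + E t)) (Icc t₀ t₁) :=
    (isSobolev_id_smul h hY).continuousOn h
  set u : C(Icc t₀ t₁, H) := ⟨_, hYc.domRestrict⟩ with hu
  have hpos : ∀ t ∈ Icc t₀ t₁, pos h u t = t • (J (Z t) + E t) := fun t ht =>
    IccExtend_of_mem h _ ht
  have hXpos : ∀ t ∈ Icc t₀ t₁, pos h X t = t • Z t := fun t ht =>
    (smul_inv_smul₀ (h₀.trans_le ht.1).ne' _).symm
  have hresc : ∀ t ∈ Icc t₀ t₁, rescale h u t = J (Z t) + E t := fun t ht => by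
    rw [rescale, hpos t ht, inv_smul_smul₀ (h₀.trans_le ht.1).ne']
  refine ⟨u, (isH1_iff_isSobolev_rescale h₀ h u).2 (hY.congr h hresc), ?_, ?_, ?_, ?_, ?_⟩
  · rw [hpos t₀ (left_mem_Icc.2 h), hXpos t₀ (left_mem_Icc.2 h), hE, layer, sub_self, hat_zero,
      hat_of_le hs hst, one_smul, zero_smul, add_zero, add_sub_cancel]
  · rw [hpos t₁ (right_mem_Icc.2 h), hXpos t₁ (right_mem_Icc.2 h), hE, layer, sub_self, hat_zero,
      hat_of_le hs hst, one_smul, zero_smul, zero_add, add_sub_cancel]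
  · have ht₁ : 0 ≤ t₁ := h₀.le.trans h
    refine (ContinuousMap.dist_le (by positivity)).2 fun x => ?_
    have e₁ : u x = (x : ℝ) • (J (Z x) + E x) := rfl
    have e₂ : X x = (x : ℝ) • Z x := by
      rw [← hXpos x x.2, pos, IccExtend_val]
    rw [e₁, e₂, dist_eq_norm, ← smul_sub, norm_smul, Real.norm_of_nonneg (h₀.le.trans x.2.1)]
    refine mul_le_mul x.2.2 ?_ (norm_nonneg _) ht₁
    have h₁ := norm_layer_le hs (hmove (Z t₀)) (hmove (Z t₁)) x.2
    have h₂ := hmove (Z x)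
    rw [norm_sub_rev] at h₂
    calc ‖J (Z x) + E x - Z x‖ = ‖(J (Z x) - Z x) + E x‖ := by
          congr 1
          abel
      _ ≤ ‖J (Z x) - Z x‖ + ‖E x‖ := norm_add_le _ _
      _ ≤ 3 * (s ^ 2 * R) := by linarith
  · filter_upwards [ae_mem_Ioo t₀ t₁, hW.ae_hasDerivAt h, hES.ae_hasDerivAt h, hWd]
      with t ht h₁ h₂ h₃
    have e : HasDerivAt (rescale h u) (deriv (fun t => J (Z t)) t + deriv E t) t := by
      refine (h₁.add h₂).congr_of_eventuallyEq ?_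
      filter_upwards [Icc_mem_nhds ht.1 ht.2] with r hr
      exact hresc r hr
    have h₄ : ‖deriv E t‖ ≤ 2 * (s * R) := by
      have hbound := norm_deriv_le_of_lip' (f := E) (x₀ := t) (C := 2 * (s ^ 2 * R / s))
        (by positivity) (Eventually.of_forall fun r =>
          norm_layer_sub_le hs (hmove (Z t₀)) (hmove (Z t₁)) r t)
      have e₁ : s ^ 2 * R / s = s * R := by
        field_simp
      rwa [e₁] at hbound
    rw [e.deriv]
    exact (norm_add_le _ _).trans (add_le_add h₃ h₄)
  · intro t ht
    have hlog : 0 ≤ Real.log (Fintype.card ι) :=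
      Real.log_nonneg (Nat.one_le_cast.2 Fintype.card_pos)
    -- In the layers only the global bound `R` is available; elsewhere the curve is the resolvent.
    by_cases hl : t ∈ Icc t₀ (t₀ + s) ∪ Icc (t₁ - s) t₁
    · rw [indicator_of_mem hl]
      have h₁ := pow_le_pow_left₀ (norm_nonneg _) (hgR (rescale h u t)) 2
      have h₂ : 0 ≤ ‖extendedGradient (maxInner a) (Z t)‖ ^ 2 := sq_nonneg _
      have h₃ : 0 ≤ s ^ 2 * Real.log (Fintype.card ι) := by positivity
      linarith
    · rw [indicator_of_notMem hl, add_zero]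
      simp only [mem_union, mem_Icc, not_or, not_and, not_le] at hl
      have h₁ : s ≤ t - t₀ := by linarith [hl.1 ht.1]
      have h₂ : s ≤ t₁ - t := by
        by_contra hcon
        exact absurd (hl.2 (by linarith)) (not_lt.2 ht.2)
      have h₃ : rescale h u t = J (Z t) := by
        rw [hresc t ht, hE, layer, hat_of_le hs h₁, hat_of_le hs h₂, zero_smul, zero_smul,
          add_zero, add_zero]
      have h₄ := (extendedGradient_spec (subdifferential_maxInner_nonempty a (Z t))).1
      nth_rewrite 1 [← hJ (Z t)] at h₄
      have h₅ := norm_sq_resolvent_subgradient_le hτ (fun z => softMax_le_maxInner a _ z hε)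
        (fun z => maxInner_sub_le_softMax a _ z hε) (hsub (J (Z t))) h₄
      rw [h₃]
      refine h₅.trans_eq ?_
      congr 2
      field_simp

/-- The slope part of the energy, when the squared slopes increase by at most `r`, and by `B` more
on two boundary layers of width `s`. -/
theorem slope_le_of_norm_sq_le {w : ℝ → ℝ} {C : ℝ} (hw : ContinuousOn w (Icc t₀ t₁))
    (hwpos : ∀ t ∈ Icc t₀ t₁, 0 ≤ w t) (hC : ∀ t ∈ Icc t₀ t₁, ‖w t‖ ≤ C) (hs : 0 < s)
    (hst : s ≤ t₁ - t₀) {p q : ℝ → ℝ} (hp : IntegrableOn (fun t => w t * p t) (Icc t₀ t₁))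
    (hq : IntegrableOn (fun t => w t * q t) (Icc t₀ t₁)) {r B : ℝ} (hB : 0 ≤ B)
    (hle : ∀ t ∈ Icc t₀ t₁, q t ≤ p t + r
      + (Icc t₀ (t₀ + s) ∪ Icc (t₁ - s) t₁).indicator (fun _ => B) t) :
    ∫ t in Icc t₀ t₁, w t * q t
      ≤ (∫ t in Icc t₀ t₁, w t * p t) + r * (∫ t in Icc t₀ t₁, w t) + 2 * s * (C * B) := by
  set L := Icc t₀ (t₀ + s) ∪ Icc (t₁ - s) t₁ with hL
  have hLsub : L ⊆ Icc t₀ t₁ := union_subset (Icc_subset_Icc le_rfl (by linarith))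
    (Icc_subset_Icc (by linarith) le_rfl)
  have hLmeas : MeasurableSet L := measurableSet_Icc.union measurableSet_Icc
  have hLvol : volume.real L ≤ 2 * s := by
    refine (measureReal_union_le _ _).trans ?_
    rw [Real.volume_real_Icc_of_le (by linarith), Real.volume_real_Icc_of_le (by linarith)]
    linarith
  have i₁ : IntegrableOn w (Icc t₀ t₁) := hw.integrableOn_Icc
  have i₂ : IntegrableOn (L.indicator fun t => w t * B) (Icc t₀ t₁) :=
    (i₁.mul_const B).indicator hLmeas
  have i₃ : IntegrableOn (fun t => w t * p t + r * w t) (Icc t₀ t₁) := hp.add (i₁.const_mul r)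
  have hlayer : ∫ t in Icc t₀ t₁, L.indicator (fun t => w t * B) t ≤ 2 * s * (C * B) := by
    rw [integral_indicator hLmeas, Measure.restrict_restrict hLmeas, inter_eq_left.2 hLsub]
    have hfin : volume L < ⊤ :=
      (measure_mono hLsub).trans_lt (by rw [Real.volume_Icc]; exact ENNReal.ofReal_lt_top)
    have hb : ∀ t ∈ L, ‖w t * B‖ ≤ C * B := fun t ht => by
      rw [norm_mul, Real.norm_of_nonneg hB]
      exact mul_le_mul_of_nonneg_right (hC t (hLsub ht)) hB
    have hCB : 0 ≤ C * B :=
      mul_nonneg ((norm_nonneg _).trans (hC t₀ ⟨le_rfl, by linarith⟩)) hB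
    refine (le_abs_self _).trans ((norm_setIntegral_le_of_norm_le_const hfin hb).trans ?_)
    rw [mul_comm]
    exact mul_le_mul_of_nonneg_right hLvol hCB
  calc ∫ t in Icc t₀ t₁, w t * q t
      ≤ ∫ t in Icc t₀ t₁, (w t * p t + r * w t + L.indicator (fun t => w t * B) t) := by
        refine setIntegral_mono_on hq (i₃.add i₂) measurableSet_Icc fun t ht => ?_
        refine (mul_le_mul_of_nonneg_left (hle t ht) (hwpos t ht)).trans_eq ?_
        by_cases hl : t ∈ L
        · simp only [indicator_of_mem hl]
          ring
        · simp only [indicator_of_notMem hl]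
          ring
    _ = (∫ t in Icc t₀ t₁, w t * p t) + r * (∫ t in Icc t₀ t₁, w t)
        + ∫ t in Icc t₀ t₁, L.indicator (fun t => w t * B) t := by
        rw [integral_add i₃ i₂, integral_add hp (i₁.const_mul r), integral_const_mul]
    _ ≤ _ := by linarith

theorem tendsto_sqrt_sqrt : Tendsto (fun ε : ℝ => √√ε) (𝓝[>] 0) (𝓝[>] 0) := by
  refine tendsto_nhdsWithin_iff.2 ⟨?_, ?_⟩
  · have : Continuous fun ε : ℝ => √√ε := by fun_prop
    simpa using (this.tendsto 0).mono_left nhdsWithin_le_nhds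
  · filter_upwards [self_mem_nhdsWithin] with ε hε
    exact Real.sqrt_pos.2 (Real.sqrt_pos.2 hε)

theorem exists_limsup_le_actionLim {d N : ℕ} (A P Q : Config d N) {t₀ t₁ : ℝ} (h₀ : 0 < t₀)
    (h : t₀ < t₁) {β : ℝ → ℝ} (hβ : ContDiffOn ℝ ∞ β (Ioi 0)) (hβpos : ∀ t > 0, 0 < β t)
    (X : C(Icc t₀ t₁, Config d N)) :
    ∃ u : ℝ → C(Icc t₀ t₁, Config d N), Tendsto u (𝓝[>] 0) (𝓝 X) ∧
      limsup (fun ε => actionEps A P Q h.le β ε (u ε)) (𝓝[>] 0) ≤ actionLim A P Q h.le β X := by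
  by_cases hXtop : actionLim A P Q h.le β X = ⊤
  · exact ⟨fun _ => X, tendsto_const_nhds, by rw [hXtop]; exact le_top⟩
  obtain ⟨hX, hXP, hXQ⟩ := action_ne_top hXtop
  have hR := fun σ => (norm_permute A σ).le
  -- The curve at temperature `ε` is the recovery curve with parameter `s = ε ^ (1 / 4)`.
  have hex : ∀ s : ℝ, 0 < s → s ≤ t₁ - t₀ → _ := fun s hs hst =>
    exists_recovery_curve (permute A) hR h₀ h.le hX hs hst
  choose! v hv using hex
  have hsmall : ∀ᶠ ε : ℝ in 𝓝[>] 0, 0 < √√ε ∧ √√ε ≤ t₁ - t₀ :=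
    (tendsto_sqrt_sqrt.eventually self_mem_nhdsWithin).and
      ((tendsto_sqrt_sqrt.mono_right nhdsWithin_le_nhds).eventually
        (ge_mem_nhds (sub_pos.2 h)))
  have hs₀ : Tendsto (fun ε : ℝ => √√ε) (𝓝[>] 0) (𝓝 0) :=
    tendsto_sqrt_sqrt.mono_right nhdsWithin_le_nhds
  have hlim : Tendsto (fun ε => v √√ε) (𝓝[>] 0) (𝓝 X) := by
    rw [tendsto_iff_dist_tendsto_zero]
    refine squeeze_zero' (Eventually.of_forall fun _ => dist_nonneg)
      (hsmall.mono fun ε hε => (hv _ hε.1 hε.2).2.2.2.1) ?_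
    simpa using (((hs₀.pow 2).mul_const ‖A‖).const_mul 3).const_mul t₁
  refine ⟨fun ε => v √√ε, hlim, ?_⟩
  have hptlim : ∀ t ∈ Icc t₀ t₁, Tendsto (fun ε => rescale h.le (v √√ε) t) (𝓝[>] 0)
      (𝓝 (rescale h.le X t)) := fun t _ => tendsto_rescale h.le hlim t
  have hbd : ∀ᶠ ε : ℝ in 𝓝[>] 0, ∀ t ∈ Icc t₀ t₁,
      ‖rescale h.le (v √√ε) t‖ ≤ t₀⁻¹ * (‖X‖ + 1) := by
    filter_upwards [hlim.norm.eventually (ge_mem_nhds (lt_add_one ‖X‖))] with ε hε t ht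
    exact (norm_rescale_le h₀ h.le _ ht).trans
      (mul_le_mul_of_nonneg_left hε (inv_pos.2 h₀).le)
  have hC := tendsto_crossTerm_softMax (permute A) h₀ h.le hβ (ε := id) tendsto_id
    (Eventually.of_forall fun ε => continuousOn_rescale h₀ h.le (v √√ε)) hbd hptlim
  set Z := rescale h.le X with hZdef
  have hZ : IsSobolev Z t₀ t₁ := (isH1_iff_isSobolev_rescale h₀ h.le X).1 hX
  have hβc := (continuousOn_weight (b := t₁) hβ h₀).1
  have hρ : ContinuousOn (fun t => t ^ 2 * β t) (Icc t₀ t₁) := (continuousOn_id.pow 2).mul hβc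
  have hw : ContinuousOn (fun t => β t / (4 * t ^ 2)) (Icc t₀ t₁) :=
    hβc.div (continuousOn_const.mul (continuousOn_id.pow 2)) fun t ht =>
      (mul_pos four_pos (pow_pos (h₀.trans_le ht.1) 2)).ne'
  obtain ⟨Cw, hCw⟩ := isCompact_Icc.exists_bound_of_continuousOn hw
  have hρpos : ∀ t ∈ Icc t₀ t₁, 0 ≤ t ^ 2 * β t := fun t ht =>
    mul_nonneg (sq_nonneg t) (hβpos t (h₀.trans_le ht.1)).le
  have hwpos : ∀ t ∈ Icc t₀ t₁, 0 ≤ β t / (4 * t ^ 2) := fun t ht =>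
    div_nonneg (hβpos t (h₀.trans_le ht.1)).le (by positivity)
  set K := ∫ t in Icc t₀ t₁, t ^ 2 * β t * ‖deriv Z t‖ ^ 2 with hK
  set S := ∫ t in Icc t₀ t₁, β t / (4 * t ^ 2) *
    ‖extendedGradient (maxInner (permute A)) (Z t)‖ ^ 2 with hS
  set K₁ := ∫ t in Icc t₀ t₁, t ^ 2 * β t * ‖deriv Z t‖
  set K₂ := ∫ t in Icc t₀ t₁, t ^ 2 * β t
  set S₁ := ∫ t in Icc t₀ t₁, β t / (4 * t ^ 2)
  set Λ := Real.log (Fintype.card (Equiv.Perm (Fin N)))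
  have hbound : ∀ᶠ ε : ℝ in 𝓝[>] 0, actionEps A P Q h.le β ε (v √√ε) ≤ ENNReal.ofReal
      ((K + 2 * (2 * (√√ε * ‖A‖)) * K₁ + (2 * (√√ε * ‖A‖)) ^ 2 * K₂)
        + (S + 2 * (√√ε ^ 2 * Λ) * S₁ + 2 * √√ε * (Cw * ‖A‖ ^ 2))
        + crossTerm β (softMax (permute A) ε) (fun z => inner ℝ (gibbsMean (permute A) ε z) z)
          (rescale h.le (v √√ε)) t₀ t₁) := by
    filter_upwards [hsmall, self_mem_nhdsWithin] with ε hsε hε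
    obtain ⟨hH1, hP', hQ', -, hd, hg⟩ := hv _ hsε.1 hsε.2
    have hε4 : √√ε ^ 4 = ε := by
      rw [show 4 = 2 * 2 from rfl, pow_mul, Real.sq_sqrt (Real.sqrt_nonneg ε),
        Real.sq_sqrt (le_of_lt hε)]
    rw [hε4] at hg
    rw [actionEps_eq_energy A P Q h₀ h.le hβ hβpos hε hH1 (by rwa [hP']) (by rwa [hQ'])]
    refine ENNReal.ofReal_le_ofReal ?_
    rw [energy]
    refine add_le_add (add_le_add ?_ ?_) le_rfl
    · exact kinetic_le_of_norm_deriv_le (ρ := fun t => t ^ 2 * β t) hρ hρpos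
        ((isH1_iff_isSobolev_rescale h₀ h.le _).1 hH1) hZ hd
    · refine slope_le_of_norm_sq_le (w := fun t => β t / (4 * t ^ 2)) hw hwpos hCw hsε.1 hsε.2
        (integrableOn_slope h₀ hβ (norm_extendedGradient_permute_le A)
          (aestronglyMeasurable_norm_extendedGradient _ (continuousOn_rescale h₀ h.le X)))
        (integrableOn_slope h₀ hβ (norm_gibbsMean_permute_le A ε)
          (((continuous_gibbsMean _ ε).norm.comp_continuousOn
            (continuousOn_rescale h₀ h.le (v √√ε))).aestronglyMeasurable measurableSet_Icc))
        (sq_nonneg _) hg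
  have hRHS := ENNReal.tendsto_ofReal (((((((hs₀.mul_const ‖A‖).const_mul 2).const_mul 2).mul_const
    K₁).const_add K).add ((((hs₀.mul_const ‖A‖).const_mul 2).pow 2).mul_const K₂)).add
    (((((hs₀.pow 2).mul_const Λ).const_mul 2).mul_const S₁).const_add S |>.add
      ((hs₀.const_mul 2).mul_const (Cw * ‖A‖ ^ 2))) |>.add hC)
  refine (limsup_le_limsup hbound).trans ?_
  refine (hRHS.limsup_eq).le.trans_eq ?_
  rw [actionLim_eq_energy A P Q h₀ h.le hβ hβpos hX hXP hXQ, energy]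
  congr 1
  simp [hK, hS, hZdef]

end Recovery

end MongeAmpere

end

theorem theorem2p2 {d N : ℕ} (A P Q : MongeAmpere.Config d N) (t₀ t₁ : ℝ)
    (ht₀ : 0 < t₀) (ht : t₀ < t₁) (β : ℝ → ℝ)
    (hβ : ContDiffOn ℝ ∞ β (Set.Ioi 0)) (hβpos : ∀ t > 0, 0 < β t) :
    MongeAmpere.GammaConverges
      (fun ε => MongeAmpere.actionEps A P Q ht.le β ε)
      (MongeAmpere.actionLim A P Q ht.le β) :=
  ⟨MongeAmpere.actionLim_le_liminf A P Q ht₀ ht.le hβ hβpos,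
    MongeAmpere.exists_limsup_le_actionLim A P Q ht₀ ht hβ hβpos⟩
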